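/- Let $m>0$, $\alpha\in[1,2)$, $T>0$, and let $\phi_-,\phi_+\in\mathbb R$ satisfy $|\phi_+-\phi_-|\le 2\pi$. Consider the planar Kepler-type problem $$\ddot x(t)=-\frac{m\,x(t)}{|x(t)|^{\alpha+2}},\qquad x(t)\in\mathbb C\setminus\{0\},$$ and, for $x\in H^1([-T,T],\mathbb C)$, its action $$\bar A_T(x)=\int_{-T}^{T}\Big(\tfrac12|\dot x(t)|^2+\frac{m}{\alpha|x(t)|^{\alpha}}\Big)\,dt\in[0,\infty]$$ (the integrand is $+\infty$ where $x(t)=0$). Let $\bar x$ be the parabolic collision-ejection solution: $\bar x(t)=(\mu|t|)^{\frac{2}{\alpha+2}}e^{i\phi_+}$ for $t\ge 0$ and $\bar x(t)=(\mu|t|)^{\frac{2}{\alpha+2}}e^{i\phi_-}$ for $t\le 0$, where $\mu=(\alpha+2)\big(\tfrac{m}{2\alpha}\big)^{1/2}$. Let $\Gamma^*_T(\bar x)$ be the set of all $x\in H^1([-T,T],\mathbb C)$ with $x(t)\neq 0$ for all $t\in[-T,T]$ and $x(\pm T)=\bar x(\pm T)$ for which there is a continuous $\theta:[-T,T]\to\mathbb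 R$ with $x=|x|e^{i\theta}$ and $\theta(\pm T)=\phi_\pm$. Let $\Gamma_T(\bar x)$ be its weak (sequential) closure in $H^1([-T,T],\mathbb C)$, that is, the set of limits of weakly convergent sequences of elements of $\Gamma^*_T(\bar x)$, and let $\bar c_T(\bar x)=\inf\{\bar A_T(x):x\in\Gamma_T(\bar x)\}$. Then $\bar c_T(\bar x)$ is finite and there is a $\gamma\in\Gamma_T(\bar x)$ with $\bar A_T(\gamma)=\bar c_T(\bar x)$. Moreover, every such $\gamma$ has the following properties. 1. If $\alpha\in(1,2)$, then $\gamma\in\Gamma^*_T(\bar x)$ and $\bar A_T(\gamma)<\bar A_T(\bar x)$. 2. If $\alpha=1$ and $|\phi_+-\phi_-|<2\pi$, then $\gamma\in\Gamma^*_T(\bar x)$ and $\bar A_T(\gamma)<\bar A_T(\bar x)$. 3. If $\phi_+\ne\phi_-$, then $\gamma$ is twice differentiable and satisfies the Kepler-type equation at all times $t\in[-T,T]$ with $\gamma(t)\neq 0$ (with one-sided derivatives at $t=\pm T$); in particular, in the situations of 1 and 2 it is a classical solution on all of $[-T,T]$. -/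

import Mathlib

open MeasureTheory Set Filter Topology
open scoped ENNReal

noncomputable section

namespace Kepler

/-! ### The Sobolev space `H¹([-T, T], ℂ)` -/

/-- Lebesgue measure on `[-T, T]`. -/
abbrev timeMeasure (T : ℝ) : Measure ℝ := volume.restrict (Icc (-T) T)

/-- `x` is (the continuous representative of) an `H¹` function on `[-T, T]`: it is absolutely
continuous there and its almost everywhere derivative is square integrable.
Only the restriction of `x` to `[-T, T]` matters. -/
structure MemH1 (T : ℝ) (x : ℝ → ℂ) : Prop where
  absCont : AbsolutelyContinuousOnInterval x (-T) T
  memLp_deriv : MemLp (deriv x) 2 (timeMeasure T)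

theorem ae_differentiableAt_of_absCont {T : ℝ} {x : ℝ → ℂ}
    (hx : AbsolutelyContinuousOnInterval x (-T) T) :
    ∀ᵐ t ∂(timeMeasure T), DifferentiableAt ℝ x t := by
  have h := hx.boundedVariationOn.locallyBoundedVariationOn.ae_differentiableWithinAt_of_mem
  have hne : ∀ᵐ t : ℝ, t ≠ -T ∧ t ≠ T := by
    have h1 : ∀ᵐ t : ℝ, t ≠ -T := by simp [ae_iff]
    have h2 : ∀ᵐ t : ℝ, t ≠ T := by simp [ae_iff]
    filter_upwards [h1, h2] with t a b using ⟨a, b⟩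
  rw [timeMeasure, ae_restrict_iff' measurableSet_Icc]
  filter_upwards [h, hne] with t ht hne htI
  have hlt1 : -T < t := lt_of_le_of_ne htI.1 (Ne.symm hne.1)
  have hlt2 : t < T := lt_of_le_of_ne htI.2 hne.2
  have hu : uIcc (-T) T ∈ 𝓝 t := by
    rw [uIcc_of_le (by linarith)]
    exact Icc_mem_nhds hlt1 hlt2
  exact (ht (mem_of_mem_nhds hu)).differentiableAt hu

theorem deriv_add_ae {T : ℝ} {x y : ℝ → ℂ} (hx : MemH1 T x) (hy : MemH1 T y) :
    deriv (x + y) =ᵐ[timeMeasure T] deriv x + deriv y := by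
  filter_upwards [ae_differentiableAt_of_absCont hx.absCont,
    ae_differentiableAt_of_absCont hy.absCont] with t h1 h2
  simpa using deriv_add h1 h2

theorem deriv_smul_ae {T : ℝ} (c : ℂ) {x : ℝ → ℂ} (hx : MemH1 T x) :
    deriv (c • x) =ᵐ[timeMeasure T] c • deriv x := by
  filter_upwards [ae_differentiableAt_of_absCont hx.absCont] with t h1
  simpa using deriv_const_smul c h1

theorem MemH1.memLp {T : ℝ} {x : ℝ → ℂ} (hx : MemH1 T x) : MemLp x 2 (timeMeasure T) := by
  have hc : ContinuousOn x (Icc (-T) T) := hx.absCont.continuousOn.mono Icc_subset_uIcc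
  obtain ⟨C, hC⟩ := isCompact_Icc.exists_bound_of_continuousOn hc
  refine MemLp.of_bound (hc.aestronglyMeasurable measurableSet_Icc) C ?_
  rw [ae_restrict_iff' measurableSet_Icc]
  exact ae_of_all _ hC

/-- The vector space of `H¹` curves on `[-T, T]`, as honest functions. -/
def H1Curve (T : ℝ) : Submodule ℂ (ℝ → ℂ) where
  carrier := {x | MemH1 T x}
  zero_mem' := ⟨
      ContDiffOn.absolutelyContinuousOnInterval (f := fun _ : ℝ => (0 : ℂ))
        (a := -T) (b := T) contDiffOn_const, by
      have : deriv (0 : ℝ → ℂ) = 0 := by ext t; exact deriv_const t 0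
      rw [this]; exact MemLp.zero⟩
  add_mem' {_ _} hx hy := ⟨hx.absCont.add hy.absCont,
    (hx.memLp_deriv.add hy.memLp_deriv).ae_eq (deriv_add_ae hx hy).symm⟩
  smul_mem' c _ hx := ⟨hx.absCont.const_smul c,
    (hx.memLp_deriv.const_smul c).ae_eq (deriv_smul_ae c hx).symm⟩

/-- `L²([-T, T], ℂ)`. -/
abbrev L2 (T : ℝ) := Lp ℂ 2 (timeMeasure T)

/-- The map `x ↦ (x, ẋ)` into the Hilbert space `L² × L²`. -/
def jet (T : ℝ) : H1Curve T →ₗ[ℂ] WithLp 2 (L2 T × L2 T) where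
  toFun x := WithLp.toLp 2 (MemLp.toLp _ (MemH1.memLp x.2), MemLp.toLp _ x.2.memLp_deriv)
  map_add' x y := by
    rw [← WithLp.toLp_add, Prod.mk_add_mk, ← MemLp.toLp_add, ← MemLp.toLp_add]
    congr 2
    exact MemLp.toLp_congr _ _ (deriv_add_ae x.2 y.2)
  map_smul' c x := by
    rw [RingHom.id_apply, ← WithLp.toLp_smul, Prod.smul_mk, ← MemLp.toLp_const_smul,
      ← MemLp.toLp_const_smul]
    congr 2
    exact MemLp.toLp_congr _ _ (deriv_smul_ae c x.2)

/-- The Sobolev space `H¹([-T, T], ℂ)`, with the norm `(‖x‖² + ‖ẋ‖²)^(1/2)` (norms in `L²`). -/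
abbrev H1 (T : ℝ) := LinearMap.range (jet T)

/-- The element of the Sobolev space given by an `H¹` curve. -/
def toH1 (T : ℝ) : H1Curve T →ₗ[ℂ] H1 T := (jet T).rangeRestrict

/-- `x n ⇀ y` weakly in `H¹([-T, T], ℂ)`. -/
def WeaklyTendsto (T : ℝ) (x : ℕ → H1Curve T) (y : H1Curve T) : Prop :=
  Tendsto (fun n => toWeakSpace ℂ (H1 T) (toH1 T (x n))) atTop
    (𝓝 (toWeakSpace ℂ (H1 T) (toH1 T y)))

/-- The weak closure in the sense of the direct method: all limits of weakly convergent sequences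
of elements of `S`. -/
def weakClosure (T : ℝ) (S : Set (H1Curve T)) : Set (H1Curve T) :=
  {y | ∃ x : ℕ → H1Curve T, (∀ n, x n ∈ S) ∧ WeaklyTendsto T x y}

/-! ### The Kepler-type problem -/

/-- The negative potential `m / (α |z|^α)`, equal to `∞` at `z = 0` (for `m > 0`, `α > 0`). -/
def potential (m α : ℝ) (z : ℂ) : ℝ≥0∞ := ENNReal.ofReal (m / α) / ‖z‖ₑ ^ α

/-- The action `∫_{-T}^{T} (|ẋ|² / 2 + m / (α |x|^α)) dt`, with values in `[0, ∞]`. -/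
def action (m α T : ℝ) (x : ℝ → ℂ) : ℝ≥0∞ :=
  ∫⁻ t in Icc (-T) T, (ENNReal.ofReal (‖deriv x t‖ ^ 2 / 2) + potential m α (x t))

/-- The curve `x` solves `ẍ = - m x / |x|^(α + 2)` on the set of times `s`, without collision
(one-sided derivatives at end points of `s` that belong to `s`). -/
def IsSolutionOn (m α : ℝ) (s : Set ℝ) (x : ℝ → ℂ) : Prop :=
  ∃ v : ℝ → ℂ, ∀ t ∈ s, x t ≠ 0 ∧ HasDerivWithinAt x (v t) s t ∧
    HasDerivWithinAt v (-(m / ‖x t‖ ^ (α + 2)) • x t) s t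

/-- The constant `μ = (α + 2) (m / (2 α))^(1/2)`. -/
def mu (m α : ℝ) : ℝ := (α + 2) * (m / (2 * α)) ^ (1 / 2 : ℝ)

/-- The parabolic collision-ejection solution with angles `φm` (for `t < 0`) and `φp`
(for `t > 0`). -/
def xbar (m α φm φp : ℝ) (t : ℝ) : ℂ :=
  (((mu m α * |t|) ^ (2 / (α + 2)) : ℝ) : ℂ) *
    Complex.exp ((if 0 ≤ t then φp else φm : ℝ) * Complex.I)

/-- The collision-free `H¹` curves on `[-T, T]` with the same end points as the collision-ejection
solution, such that a continuous determination of the argument runs from `φm` to `φp`. -/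
def GammaStar (m α T φm φp : ℝ) : Set (H1Curve T) :=
  {x | (∀ t ∈ Icc (-T) T, (x : ℝ → ℂ) t ≠ 0) ∧
    (x : ℝ → ℂ) (-T) = xbar m α φm φp (-T) ∧ (x : ℝ → ℂ) T = xbar m α φm φp T ∧
    ∃ θ : ℝ → ℝ, ContinuousOn θ (Icc (-T) T) ∧ θ (-T) = φm ∧ θ T = φp ∧
      ∀ t ∈ Icc (-T) T,
        (x : ℝ → ℂ) t = (‖(x : ℝ → ℂ) t‖ : ℂ) * Complex.exp ((θ t : ℂ) * Complex.I)}

/-- The weak closure of `GammaStar` in `H¹([-T, T], ℂ)`. -/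
def Gamma (m α T φm φp : ℝ) : Set (H1Curve T) := weakClosure T (GammaStar m α T φm φp)

/-- The infimum of the action over `Gamma`. -/
def cbar (m α T φm φp : ℝ) : ℝ≥0∞ :=
  ⨅ x ∈ Gamma m α T φm φp, action m α T (x : ℝ → ℂ)

end Kepler

end

noncomputable section

namespace Kepler

/-! ### Calculus of absolutely continuous curves -/

/-! The existence part is the direct method. Bounded action bounds the velocities in `L²`; with a
common left end point this gives a weakly convergent subsequence (`exists_weak_limit`), weak
convergence is uniform, and the action is lower semicontinuous (`action_le_of_weaklyTendsto`).

The threshold for collisions comes from the Jacobi length at zero energy. Since `w ^ 2 / 2 + U ≥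
√(2U) w`, an arc from radius `r` to the origin costs at least `jacobi m α r`. Hence a curve of the
class that meets the origin costs at least `2 * jacobi m α (rbar m α T)` (`two_jacobi_le_action`),
and the collision-ejection solution costs at least as much.

To beat this threshold, put `β = 1 - α / 2`. In the variable `x ^ β` the Jacobi metric at zero
energy is flat, and the collision-ejection path becomes two segments meeting at the origin at angle
`β * |φp - φm|`. If this angle is less than `π`, the corner can be cut by a chord. Cutting at the
radius reached at time `s` saves an action of at least a constant times `s`. The chord takes a
different time from the two segments it replaces, so the radial arcs are stretched linearly in time,
which costs only `O(s ^ 2)`. Small `s` therefore gives a collision-free curve below the threshold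
(`exists_mem_GammaStar_action_lt`). The angle condition holds for `α > 1` because then `β < 1 / 2`,
and for `α = 1` it says `|φp - φm| < 2π`.

The equation of motion holds away from collisions because the weak closure is stable under small
variations supported there (`add_mem_Gamma`), so the first variation vanishes. Regularity follows by
comparing the minimizer with the solution `q` of `q'' = force (x t)` having the same end values
(`exists_solution_of_minimizer`). -/

theorem absCont_comp_lipschitz {X Y : Type*} [PseudoMetricSpace X] [PseudoMetricSpace Y]
    {f : ℝ → X} {g : X → Y} {a b : ℝ} {K : NNReal} {s : Set X}
    (hf : AbsolutelyContinuousOnInterval f a b) (hg : LipschitzOnWith K g s)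
    (hs : MapsTo f (uIcc a b) s) : AbsolutelyContinuousOnInterval (fun t => g (f t)) a b := by
  unfold AbsolutelyContinuousOnInterval at hf ⊢
  refine squeeze_zero' (Eventually.of_forall fun _ => Finset.sum_nonneg fun _ _ => dist_nonneg) ?_
    (by simpa using hf.const_mul (K : ℝ))
  rw [eventually_inf_principal]
  filter_upwards with E hE
  rw [Finset.mul_sum]
  refine Finset.sum_le_sum fun i hi => ?_
  exact hg.dist_le_mul _ (hs (hE.1 i hi).1) _ (hs (hE.1 i hi).2)

theorem absCont_congr {X : Type*} [PseudoMetricSpace X] {f g : ℝ → X} {a b : ℝ}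
    (hf : AbsolutelyContinuousOnInterval f a b) (h : EqOn f g (uIcc a b)) :
    AbsolutelyContinuousOnInterval g a b := by
  unfold AbsolutelyContinuousOnInterval at hf ⊢
  refine hf.congr' ?_
  filter_upwards [mem_inf_of_right (mem_principal_self _)] with E hE
  refine Finset.sum_congr rfl fun i hi => ?_
  rw [h (hE.1 i hi).1, h (hE.1 i hi).2]

theorem absCont_ofReal_add {f g : ℝ → ℝ} {a b : ℝ}
    (hf : AbsolutelyContinuousOnInterval f a b) (hg : AbsolutelyContinuousOnInterval g a b) :
    AbsolutelyContinuousOnInterval (fun t => (f t : ℂ) + (g t : ℂ) * Complex.I) a b := by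
  have h1 : AbsolutelyContinuousOnInterval (fun t => (f t : ℂ)) a b :=
    absCont_comp_lipschitz (s := univ) hf
      (Complex.isometry_ofReal.lipschitz.lipschitzOnWith) (mapsTo_univ _ _)
  have h2 : AbsolutelyContinuousOnInterval (fun t => (g t : ℂ)) a b :=
    absCont_comp_lipschitz (s := univ) hg
      (Complex.isometry_ofReal.lipschitz.lipschitzOnWith) (mapsTo_univ _ _)
  have h3 := h1.add (h2.const_smul Complex.I)
  refine absCont_congr h3 fun t _ => ?_
  simp [mul_comm]

/-- The primitive of an integrable complex function is absolutely continuous. -/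
theorem absCont_integral {v : ℝ → ℂ} {a b : ℝ} (hv : IntervalIntegrable v volume a b) :
    AbsolutelyContinuousOnInterval (fun t => ∫ u in a..t, v u) a b := by
  have hre : IntervalIntegrable (fun t => (v t).re) volume a b :=
    ⟨hv.1.re, hv.2.re⟩
  have him : IntervalIntegrable (fun t => (v t).im) volume a b :=
    ⟨hv.1.im, hv.2.im⟩
  refine absCont_congr (absCont_ofReal_add
    (hre.absolutelyContinuousOnInterval_intervalIntegral (c := a) left_mem_uIcc)
    (him.absolutelyContinuousOnInterval_intervalIntegral (c := a) left_mem_uIcc)) fun t ht => ?_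
  have hvt : IntervalIntegrable v volume a t := hv.mono_set (uIcc_subset_uIcc_left ht)
  have e1 := Complex.reCLM.intervalIntegral_comp_comm hvt
  have e2 := Complex.imCLM.intervalIntegral_comp_comm hvt
  simp only [Complex.reCLM_apply, Complex.imCLM_apply] at e1 e2
  simp only [e1, e2, Complex.re_add_im]

/-- The fundamental theorem of calculus for absolutely continuous complex curves. -/
theorem integral_deriv_complex {f : ℝ → ℂ} {a b : ℝ}
    (hf : AbsolutelyContinuousOnInterval f a b)
    (hi : IntervalIntegrable (deriv f) volume a b) :
    ∫ t in a..b, deriv f t = f b - f a := by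
  have hd : ∀ᵐ t : ℝ, t ∈ uIcc a b → DifferentiableAt ℝ f t := by
    have hre : AbsolutelyContinuousOnInterval (fun t => (f t).re) a b :=
      absCont_comp_lipschitz (s := univ) hf Complex.reCLM.lipschitz.lipschitzOnWith
        (mapsTo_univ _ _)
    have him : AbsolutelyContinuousOnInterval (fun t => (f t).im) a b :=
      absCont_comp_lipschitz (s := univ) hf Complex.imCLM.lipschitz.lipschitzOnWith
        (mapsTo_univ _ _)
    filter_upwards [hre.ae_differentiableAt, him.ae_differentiableAt] with t h1 h2 ht
    have h3 : DifferentiableAt ℝ (fun t => ((f t).re : ℂ) + ((f t).im : ℂ) * Complex.I) t :=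
      ((Complex.ofRealCLM.differentiableAt.comp t (h1 ht))).add
        ((Complex.ofRealCLM.differentiableAt.comp t (h2 ht)).mul_const _)
    simpa only [Complex.re_add_im] using h3
  have hg : AbsolutelyContinuousOnInterval (fun t => f t - ∫ u in a..t, deriv f u) a b :=
    hf.sub (absCont_integral hi)
  obtain ⟨C, hC⟩ := hg.const_of_ae_hasDerivAt_zero (by
    filter_upwards [hd, hi.ae_hasDerivAt_integral] with t h1 h2 ht
    have h3 := (h1 ht).hasDerivAt.sub (h2 ht a left_mem_uIcc)
    rwa [sub_self] at h3)
  have h1 := hC a left_mem_uIcc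
  have h2 := hC b right_mem_uIcc
  simp only [intervalIntegral.integral_same, sub_zero] at h1
  rw [← h1] at h2
  rw [← h2]; ring

theorem MemLp.intervalIntegrable {T : ℝ} {v : ℝ → ℂ} (hv : MemLp v 2 (timeMeasure T)) {a b : ℝ}
    (ha : a ∈ Icc (-T) T) (hb : b ∈ Icc (-T) T) : IntervalIntegrable v volume a b := by
  have h : IntegrableOn v (Icc (-T) T) volume := hv.integrable (by norm_num)
  rw [intervalIntegrable_iff]
  exact h.mono_set (uIoc_subset_uIcc.trans (uIcc_subset_Icc ha hb))

theorem MemH1.sub_eq_integral {T : ℝ} {x : ℝ → ℂ} (hx : MemH1 T x) {a b : ℝ}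
    (ha : a ∈ Icc (-T) T) (hb : b ∈ Icc (-T) T) : ∫ t in a..b, deriv x t = x b - x a :=
  integral_deriv_complex (hx.absCont.mono ((uIcc_subset_Icc ha hb).trans Icc_subset_uIcc))
    (MemLp.intervalIntegrable hx.memLp_deriv ha hb)

theorem ae_timeMeasure_mem_Ioo (T : ℝ) : ∀ᵐ t ∂(timeMeasure T), t ∈ Ioo (-T) T := by
  rw [timeMeasure, ← Measure.restrict_congr_set Ioo_ae_eq_Icc]
  exact ae_restrict_mem measurableSet_Ioo

/-- A primitive of a square integrable function is an `H¹` curve. -/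
theorem memH1_of_eq_integral {T : ℝ} (hT : 0 < T) {x v : ℝ → ℂ} {c : ℂ}
    (hv : MemLp v 2 (timeMeasure T)) (hx : ∀ t ∈ Icc (-T) T, x t = c + ∫ u in (-T)..t, v u) :
    MemH1 T x ∧ deriv x =ᵐ[timeMeasure T] v := by
  have hle : -T ≤ T := by linarith
  have hi := MemLp.intervalIntegrable hv (left_mem_Icc.2 hle) (right_mem_Icc.2 hle)
  have hd : deriv x =ᵐ[timeMeasure T] v := by
    have h := hi.ae_hasDerivAt_integral
    filter_upwards [ae_restrict_of_ae h, ae_timeMeasure_mem_Ioo T] with t ht htI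
    have hm : t ∈ uIcc (-T) T := Icc_subset_uIcc (Ioo_subset_Icc_self htI)
    refine HasDerivAt.deriv ?_
    refine ((ht hm (-T) left_mem_uIcc).const_add c).congr_of_eventuallyEq ?_
    filter_upwards [Icc_mem_nhds htI.1 htI.2] with u hu using hx u hu
  refine ⟨⟨?_, hv.ae_eq hd.symm⟩, hd⟩
  have hc : AbsolutelyContinuousOnInterval (fun _ : ℝ => c) (-T) T :=
    ContDiffOn.absolutelyContinuousOnInterval contDiffOn_const
  refine absCont_congr (hc.add (absCont_integral hi)) fun t ht => ?_
  rw [uIcc_of_le hle] at ht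
  exact (hx t ht).symm

/-- A continuous curve which is differentiable away from a countable set, and whose derivative
has finite energy, is an `H¹` curve. -/
theorem memH1_of_energy {T : ℝ} (hT : 0 < T) {x : ℝ → ℂ} {s : Set ℝ} (hs : s.Countable)
    (hx : ContinuousOn x (Icc (-T) T)) (hd : ∀ t ∈ Ioo (-T) T \ s, DifferentiableAt ℝ x t)
    (he : ∫⁻ t in Icc (-T) T, ENNReal.ofReal (‖deriv x t‖ ^ 2 / 2) ≠ ⊤) : MemH1 T x := by
  have hle : -T ≤ T := by linarith
  have hb : MemLp (deriv x) 2 (timeMeasure T) := by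
    rw [memLp_two_iff_integrable_sq_norm (stronglyMeasurable_deriv x).aestronglyMeasurable]
    have h : Integrable (fun t => ‖deriv x t‖ ^ 2 / 2) (timeMeasure T) := by
      refine (lintegral_ofReal_ne_top_iff_integrable ?_ (ae_of_all _ fun t => by positivity)).1 he
      exact (((measurable_deriv x).norm.pow_const 2).div_const 2).aestronglyMeasurable
    simpa using h.mul_const 2
  refine (memH1_of_eq_integral hT (c := x (-T)) hb fun t ht => ?_).1
  have h := integral_eq_of_hasDerivAt_off_countable x (deriv x) hs
    (hx.mono (uIcc_of_le ht.1 ▸ Icc_subset_Icc_right ht.2)) (fun u hu => (hd u ⟨by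
      have := hu.1
      rw [min_eq_left ht.1, max_eq_right ht.1] at this
      exact ⟨this.1, this.2.trans_le ht.2⟩, hu.2⟩).hasDerivAt)
    (MemLp.intervalIntegrable hb (left_mem_Icc.2 hle) ht)
  rw [h]; ring

/-! ### Weak convergence in `H¹` -/

/-- The position of an `H¹` curve, as an element of `L²`. -/
def pos {T : ℝ} (x : H1Curve T) : L2 T := MemLp.toLp _ (MemH1.memLp x.2)

/-- The velocity of an `H¹` curve, as an element of `L²`. -/
def vel {T : ℝ} (x : H1Curve T) : L2 T := MemLp.toLp _ x.2.memLp_deriv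

theorem coeFn_pos {T : ℝ} (x : H1Curve T) : pos x =ᵐ[timeMeasure T] (x : ℝ → ℂ) :=
  MemLp.coeFn_toLp _

theorem coeFn_vel {T : ℝ} (x : H1Curve T) : vel x =ᵐ[timeMeasure T] deriv (x : ℝ → ℂ) :=
  MemLp.coeFn_toLp _

theorem weaklyTendsto_iff_dual {T : ℝ} (x : ℕ → H1Curve T) (y : H1Curve T) :
    WeaklyTendsto T x y ↔ ∀ l : StrongDual ℂ (H1 T),
      Tendsto (fun n => l (toH1 T (x n))) atTop (𝓝 (l (toH1 T y))) := by
  have hinj : Function.Injective (topDualPairing ℂ (H1 T)).flip := by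
    refine (injective_iff_map_eq_zero _).2 fun a ha => ?_
    refine SeparatingDual.eq_zero_of_forall_dual_eq_zero (R := ℂ) fun g => ?_
    exact DFunLike.congr_fun ha g
  exact WeakBilin.tendsto_iff_forall_eval_tendsto _ hinj

/-- A functional on the range of `jet` extends to `L² × L²` by Hahn-Banach and is represented there
by Riesz, so completeness of `H1 T` is not needed. -/
theorem weaklyTendsto_iff {T : ℝ} (x : ℕ → H1Curve T) (y : H1Curve T) :
    WeaklyTendsto T x y ↔
      (∀ g : L2 T, Tendsto (fun n => inner ℂ g (pos (x n))) atTop (𝓝 (inner ℂ g (pos y)))) ∧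
      ∀ g : L2 T, Tendsto (fun n => inner ℂ g (vel (x n))) atTop (𝓝 (inner ℂ g (vel y))) := by
  rw [weaklyTendsto_iff_dual]
  constructor
  · intro h
    refine ⟨fun g => ?_, fun g => ?_⟩
    · exact h (innerSL ℂ g ∘L WithLp.fstL 2 ℂ (L2 T) (L2 T) ∘L (H1 T).subtypeL)
    · exact h (innerSL ℂ g ∘L WithLp.sndL 2 ℂ (L2 T) (L2 T) ∘L (H1 T).subtypeL)
  · rintro ⟨h1, h2⟩ l
    obtain ⟨l', hl', -⟩ := exists_extension_norm_eq (H1 T) l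
    set z := (InnerProductSpace.toDual ℂ (WithLp 2 (L2 T × L2 T))).symm l' with hz
    have key : ∀ w : H1Curve T, l (toH1 T w) = inner ℂ z.fst (pos w) + inner ℂ z.snd (vel w) := by
      intro w
      rw [← hl']
      have : l' (toH1 T w) = inner ℂ z (toH1 T w : WithLp 2 (L2 T × L2 T)) := by
        rw [hz, InnerProductSpace.toDual_symm_apply]
      rw [this, WithLp.prod_inner_apply]
      rfl
    simp only [key]
    exact (h1 _).add (h2 _)

theorem exists_bound_vel {T : ℝ} {x : ℕ → H1Curve T} {y : H1Curve T} (h : WeaklyTendsto T x y) :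
    ∃ M : ℝ, 0 ≤ M ∧ ∀ n, ‖vel (x n)‖ ≤ M := by
  have h2 := ((weaklyTendsto_iff x y).1 h).2
  obtain ⟨M, hM⟩ := banach_steinhaus (g := fun n => innerSL ℂ (vel (x n))) (fun g => by
    obtain ⟨C, hC⟩ := (h2 g).norm.bddAbove_range
    refine ⟨C, fun n => ?_⟩
    rw [innerSL_apply_apply, norm_inner_symm]
    exact hC ⟨n, rfl⟩)
  refine ⟨M, (norm_nonneg _).trans (hM 0), fun n => ?_⟩
  simpa using hM n

/-- Increments of a curve are `L²` pairings of its velocity. Hence they pass to weak limits, and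
Cauchy-Schwarz turns them into the Hölder estimate `norm_sub_le_sqrt`. -/
theorem inner_indicator_vel {T : ℝ} (x : H1Curve T) {a b : ℝ} (ha : a ∈ Icc (-T) T)
    (hb : b ∈ Icc (-T) T) (hab : a ≤ b) :
    inner ℂ (indicatorConstLp 2 (μ := timeMeasure T) (measurableSet_Ioc (a := a) (b := b))
      (measure_ne_top _ _) (1 : ℂ)) (vel x) = (x : ℝ → ℂ) b - (x : ℝ → ℂ) a := by
  rw [L2.inner_indicatorConstLp_one, ← x.2.sub_eq_integral ha hb,
    intervalIntegral.integral_of_le hab]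
  have hsub : Ioc a b ⊆ Icc (-T) T := fun t ht => ⟨ha.1.trans ht.1.le, ht.2.trans hb.2⟩
  rw [setIntegral_congr_ae measurableSet_Ioc
    ((coeFn_vel x).mono fun t ht _ => ht), timeMeasure,
    Measure.restrict_restrict measurableSet_Ioc, inter_eq_left.2 hsub]

theorem norm_sub_le_sqrt {T : ℝ} (x : H1Curve T) {a b : ℝ} (ha : a ∈ Icc (-T) T)
    (hb : b ∈ Icc (-T) T) :
    ‖(x : ℝ → ℂ) b - (x : ℝ → ℂ) a‖ ≤ √|b - a| * ‖vel x‖ := by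
  wlog hab : a ≤ b generalizing a b
  · rw [norm_sub_rev, abs_sub_comm]
    exact this hb ha (le_of_not_ge hab)
  rw [← inner_indicator_vel x ha hb hab]
  refine (norm_inner_le_norm _ _).trans ?_
  gcongr
  rw [norm_indicatorConstLp (by norm_num) (by norm_num)]
  have hsub : Ioc a b ⊆ Icc (-T) T := fun t ht => ⟨ha.1.trans ht.1.le, ht.2.trans hb.2⟩
  have : (timeMeasure T).real (Ioc a b) = b - a := by
    rw [timeMeasure, measureReal_restrict_apply measurableSet_Ioc, inter_eq_left.2 hsub]
    simp [Real.volume_real_Ioc_of_le hab]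
  rw [this, abs_of_nonneg (sub_nonneg.2 hab), Real.sqrt_eq_rpow]
  simp

/-- Weakly convergent velocities and a common left end point give pointwise convergence up to
a constant. -/
theorem tendsto_apply_sub {T : ℝ} {x : ℕ → H1Curve T} {y : H1Curve T}
    (h2 : ∀ g : L2 T, Tendsto (fun n => inner ℂ g (vel (x n))) atTop (𝓝 (inner ℂ g (vel y))))
    {t : ℝ} (ht : t ∈ Icc (-T) T) :
    Tendsto (fun n => (x n : ℝ → ℂ) t - (x n : ℝ → ℂ) (-T)) atTop
      (𝓝 ((y : ℝ → ℂ) t - (y : ℝ → ℂ) (-T))) := by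
  have hl : -T ∈ Icc (-T) T := ⟨le_rfl, ht.1.trans ht.2⟩
  have := h2 (indicatorConstLp 2 (μ := timeMeasure T) (measurableSet_Ioc (a := -T) (b := t))
      (measure_ne_top _ _) (1 : ℂ))
  simpa only [inner_indicator_vel _ hl ht ht.1] using this

/-- Bounded velocities give the common modulus of continuity `√d * M`, and for equicontinuous
functions on a compact interval pointwise convergence is uniform. -/
theorem tendstoUniformlyOn_of_tendsto {T : ℝ} {x : ℕ → H1Curve T} {y : ℝ → ℂ} {M : ℝ}
    (hM : ∀ n, ‖vel (x n)‖ ≤ M)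
    (h : ∀ t ∈ Icc (-T) T, Tendsto (fun n => (x n : ℝ → ℂ) t) atTop (𝓝 (y t))) :
    TendstoUniformlyOn (fun n => (x n : ℝ → ℂ)) y atTop (Icc (-T) T) := by
  have heq : Equicontinuous (fun n => (Icc (-T) T).domRestrict (x n : ℝ → ℂ)) := by
    refine Metric.equicontinuous_of_continuity_modulus (fun d => √d * M) ?_ _ ?_
    · have : Continuous fun d : ℝ => √d * M := by fun_prop
      simpa using this.tendsto 0
    · intro s t n
      rw [dist_comm, dist_eq_norm, dist_comm, Subtype.dist_eq, Real.dist_eq]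
      refine (norm_sub_le_sqrt (x n) s.2 t.2).trans ?_
      gcongr
      exact hM n
  have h1 := (heq.tendsto_uniformFun_iff_pi atTop ((Icc (-T) T).domRestrict y)).2
    (tendsto_pi_nhds.2 fun t => h t t.2)
  rw [UniformFun.tendsto_iff_tendstoUniformly] at h1
  rw [tendstoUniformlyOn_iff_restrict]
  exact h1

/-- The pairing of a curve with the constant function `1`. -/
theorem inner_one_pos {T : ℝ} (x : H1Curve T) :
    inner ℂ (indicatorConstLp 2 (μ := timeMeasure T) MeasurableSet.univ
      (measure_ne_top _ _) (1 : ℂ)) (pos x) = ∫ t in Icc (-T) T, (x : ℝ → ℂ) t := by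
  rw [L2.inner_indicatorConstLp_one, setIntegral_univ]
  exact integral_congr_ae (coeFn_pos x)

/-- Dominated convergence; the Hölder estimate from the common left end point bounds all the curves
by `‖p‖ + √(2 * T) * M`. -/
theorem tendsto_inner_pos {T : ℝ} {x : ℕ → H1Curve T} {M : ℝ}
    (hM : ∀ n, ‖vel (x n)‖ ≤ M) {p : ℂ} (hp : ∀ n, (x n : ℝ → ℂ) (-T) = p) {z : ℝ → ℂ}
    (h : ∀ t ∈ Icc (-T) T, Tendsto (fun n => (x n : ℝ → ℂ) t) atTop (𝓝 (z t)))
    (g : L2 T) :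
    Tendsto (fun n => inner ℂ g (pos (x n))) atTop
      (𝓝 (∫ t in Icc (-T) T, inner ℂ (g t) (z t))) := by
  have hg : Integrable (fun t => ‖g t‖ * (‖p‖ + √(2 * T) * M)) (timeMeasure T) :=
    ((Lp.memLp g).integrable (by norm_num)).norm.mul_const _
  have key := tendsto_integral_of_dominated_convergence (μ := timeMeasure T)
    (F := fun n t => inner ℂ (g t) (pos (x n) t)) (f := fun t => inner ℂ (g t) (z t))
    (fun t => ‖g t‖ * (‖p‖ + √(2 * T) * M)) (fun n => (L2.integrable_inner _ _).aestronglyMeasurable)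
    hg ?_ ?_
  · simpa only [L2.inner_def] using key
  · intro n
    filter_upwards [coeFn_pos (x n), ae_restrict_mem measurableSet_Icc] with t h1 h2
    refine (norm_inner_le_norm _ _).trans ?_
    rw [h1]
    gcongr
    have hl : -T ∈ Icc (-T) T := ⟨le_rfl, h2.1.trans h2.2⟩
    have h3 := norm_sub_le_sqrt (x n) hl h2
    have h4 : √|t - -T| * ‖vel (x n)‖ ≤ √(2 * T) * M := by
      gcongr
      · rw [abs_of_nonneg (by linarith [h2.1])]; linarith [h2.2]
      · exact hM n
    calc ‖(x n : ℝ → ℂ) t‖ = ‖p + ((x n : ℝ → ℂ) t - (x n : ℝ → ℂ) (-T))‖ := by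
          rw [hp n]; ring_nf
      _ ≤ ‖p‖ + ‖(x n : ℝ → ℂ) t - (x n : ℝ → ℂ) (-T)‖ := norm_add_le _ _
      _ ≤ _ := by linarith
  · have hall : ∀ᵐ t ∂(timeMeasure T), ∀ n, pos (x n) t = (x n : ℝ → ℂ) t :=
      ae_all_iff.2 fun n => coeFn_pos (x n)
    filter_upwards [hall, ae_restrict_mem measurableSet_Icc] with t h1 h2
    simp only [h1]
    exact Tendsto.inner (𝕜 := ℂ) tendsto_const_nhds (h t h2)

/-- Weak convergence of curves with a common left end point implies uniform convergence. -/
theorem WeaklyTendsto.tendstoUniformlyOn {T : ℝ} (hT : 0 < T) {x : ℕ → H1Curve T}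
    {y : H1Curve T} (h : WeaklyTendsto T x y) {p : ℂ} (hp : ∀ n, (x n : ℝ → ℂ) (-T) = p) :
    TendstoUniformlyOn (fun n => (x n : ℝ → ℂ)) y atTop (Icc (-T) T) := by
  obtain ⟨M, -, hM⟩ := exists_bound_vel h
  obtain ⟨h1, h2⟩ := (weaklyTendsto_iff x y).1 h
  have hpt : ∀ t ∈ Icc (-T) T, Tendsto (fun n => (x n : ℝ → ℂ) t) atTop
      (𝓝 ((y : ℝ → ℂ) t + (p - (y : ℝ → ℂ) (-T)))) := by
    intro t ht
    have h3 := (tendsto_apply_sub h2 ht).add_const p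
    simp only [hp, sub_add_cancel] at h3
    convert h3 using 2
    ring
  -- The velocities determine the pointwise limit only up to the constant `p - y (-T)`. Weak
  -- convergence of the positions, tested against the function `1`, forces this constant to vanish.
  set e := indicatorConstLp 2 (μ := timeMeasure T) MeasurableSet.univ (measure_ne_top _ _) (1 : ℂ)
    with he
  have h4 := tendsto_inner_pos hM hp hpt e
  have h5 := tendsto_nhds_unique (h1 e) h4
  have hy : Integrable (y : ℝ → ℂ) (timeMeasure T) := (MemH1.memLp y.2).integrable (by norm_num)
  have h6 : p - (y : ℝ → ℂ) (-T) = 0 := by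
    have e1 : (∫ t in Icc (-T) T, inner ℂ (e t) ((y : ℝ → ℂ) t + (p - (y : ℝ → ℂ) (-T)))) =
        ∫ t in Icc (-T) T, ((y : ℝ → ℂ) t + (p - (y : ℝ → ℂ) (-T))) := by
      refine integral_congr_ae ?_
      have : e =ᵐ[timeMeasure T] fun _ => (1 : ℂ) := by
        refine (indicatorConstLp_coeFn (p := 2) (μ := timeMeasure T) (hs := MeasurableSet.univ)
          (hμs := measure_ne_top _ _) (c := (1 : ℂ))).trans ?_
        rw [indicator_univ]
      filter_upwards [this] with t ht
      simp [ht]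
    rw [e1, inner_one_pos, integral_add hy (integrable_const _)] at h5
    simp only [left_eq_add, integral_const, smul_eq_zero] at h5
    refine h5.resolve_left ?_
    rw [timeMeasure, measureReal_restrict_apply_univ,
      Real.volume_real_Icc_of_le (by linarith : -T ≤ T)]
    linarith
  refine tendstoUniformlyOn_of_tendsto hM fun t ht => ?_
  simpa [h6] using hpt t ht

/-! ### Weak compactness and lower semicontinuity of the action -/

theorem norm_vel_sq {T : ℝ} (x : H1Curve T) :
    ‖vel x‖ ^ 2 = ∫ t in Icc (-T) T, ‖deriv (x : ℝ → ℂ) t‖ ^ 2 := by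
  have h1 : (inner ℂ (vel x) (vel x) : ℂ) = ((‖vel x‖ ^ 2 : ℝ) : ℂ) := by
    rw [inner_self_eq_norm_sq_to_K]; simp
  rw [L2.inner_def] at h1
  have h2 : (∫ t in Icc (-T) T, inner ℂ (vel x t) (vel x t)) =
      ∫ t in Icc (-T) T, ((‖deriv (x : ℝ → ℂ) t‖ ^ 2 : ℝ) : ℂ) := by
    refine integral_congr_ae ?_
    filter_upwards [coeFn_vel x] with t ht
    rw [ht, inner_self_eq_norm_sq_to_K]; simp
  rw [h2, integral_complex_ofReal] at h1
  exact_mod_cast h1.symm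

theorem integrable_norm_deriv_sq {T : ℝ} (x : H1Curve T) :
    Integrable (fun t => ‖deriv (x : ℝ → ℂ) t‖ ^ 2) (timeMeasure T) :=
  x.2.memLp_deriv.integrable_norm_pow (by norm_num)

theorem lintegral_kinetic {T : ℝ} (x : H1Curve T) :
    ∫⁻ t in Icc (-T) T, ENNReal.ofReal (‖deriv (x : ℝ → ℂ) t‖ ^ 2 / 2) =
      ENNReal.ofReal (‖vel x‖ ^ 2 / 2) := by
  rw [norm_vel_sq, ← integral_div, ofReal_integral_eq_lintegral_ofReal]
  · exact (integrable_norm_deriv_sq x).div_const 2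
  · exact ae_of_all _ fun t => by positivity

/-- With values in `[0, ∞]` the potential is continuous at the origin too, so Fatou's lemma treats
collisions without a separate case. -/
theorem continuous_potential (m α : ℝ) :
    Continuous (potential m α) := by
  unfold potential
  refine continuous_iff_continuousAt.2 fun z => ?_
  refine ENNReal.Tendsto.const_div ?_ (Or.inr ENNReal.ofReal_ne_top)
  exact (ENNReal.continuous_rpow_const.comp continuous_enorm).continuousAt

theorem aemeasurable_potential (m α : ℝ) {T : ℝ} (x : H1Curve T) :
    AEMeasurable (fun t => potential m α ((x : ℝ → ℂ) t)) (timeMeasure T) :=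
  (continuous_potential m α).measurable.comp_aemeasurable
    (MemH1.memLp x.2).aestronglyMeasurable.aemeasurable

theorem action_eq {m α T : ℝ} (x : H1Curve T) :
    action m α T x = ENNReal.ofReal (‖vel x‖ ^ 2 / 2) +
      ∫⁻ t in Icc (-T) T, potential m α ((x : ℝ → ℂ) t) := by
  rw [action, lintegral_add_left, lintegral_kinetic]
  exact (((measurable_deriv (x : ℝ → ℂ)).norm.pow_const 2).div_const 2).ennreal_ofReal

/-- A bounded sequence of velocities has a weakly convergent subsequence. -/
theorem exists_weak_limit_L2 {T M : ℝ} {v : ℕ → L2 T} (hM : ∀ n, ‖v n‖ ≤ M) :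
    ∃ (w : L2 T) (φ : ℕ → ℕ), StrictMono φ ∧
      ∀ g : L2 T, Tendsto (fun n => inner ℂ g (v (φ n))) atTop (𝓝 (inner ℂ g w)) := by
  have : Fact ((2 : ℝ≥0∞) ≠ ⊤) := ⟨by norm_num⟩
  have : TopologicalSpace.SeparableSpace (L2 T) := inferInstance
  obtain ⟨f, -, φ, hφ, hf⟩ := WeakDual.isSeqCompact_closedBall ℂ (L2 T) 0 M
    (x := fun n => StrongDual.toWeakDual (InnerProductSpace.toDual ℂ (L2 T) (v n)))
    (fun n => by simpa using hM n)
  refine ⟨(InnerProductSpace.toDual ℂ (L2 T)).symm (WeakDual.toStrongDual f), φ, hφ, fun g => ?_⟩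
  rw [tendsto_iff_forall_eval_tendsto_topDualPairing] at hf
  have h1 := (hf g)
  have h2 : Tendsto (fun n => inner ℂ (v (φ n)) g) atTop
      (𝓝 (inner ℂ ((InnerProductSpace.toDual ℂ (L2 T)).symm (WeakDual.toStrongDual f)) g)) := by
    rw [InnerProductSpace.toDual_symm_apply]
    exact h1
  -- The Riesz map puts the sequence in the conjugate-linear slot; conjugation moves it to the
  -- linear one.
  have h3 := (Complex.continuous_conj.tendsto _).comp h2
  simpa only [Function.comp_def, inner_conj_symm] using h3

/-- Curves with a common left end point and bounded velocities have a weakly convergent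
subsequence. -/
theorem exists_weak_limit {T : ℝ} (hT : 0 < T) {x : ℕ → H1Curve T} {M : ℝ}
    (hM : ∀ n, ‖vel (x n)‖ ≤ M) {p : ℂ} (hp : ∀ n, (x n : ℝ → ℂ) (-T) = p) :
    ∃ (y : H1Curve T) (φ : ℕ → ℕ), StrictMono φ ∧ WeaklyTendsto T (x ∘ φ) y := by
  obtain ⟨w, φ, hφ, hw⟩ := exists_weak_limit_L2 hM
  obtain ⟨hy, hyd⟩ := memH1_of_eq_integral hT (x := fun t => p + ∫ u in (-T)..t, w u) (c := p)
    (Lp.memLp w) (fun t _ => rfl)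
  set y : H1Curve T := ⟨_, hy⟩ with hydef
  have hvel : vel y = w := by
    refine Lp.ext ((coeFn_vel y).trans hyd)
  refine ⟨y, φ, hφ, ?_⟩
  have h2 : ∀ g : L2 T, Tendsto (fun n => inner ℂ g (vel ((x ∘ φ) n))) atTop
      (𝓝 (inner ℂ g (vel y))) := by
    rw [hvel]; exact hw
  refine (weaklyTendsto_iff _ _).2 ⟨fun g => ?_, h2⟩
  have hpt : ∀ t ∈ Icc (-T) T, Tendsto (fun n => ((x ∘ φ) n : ℝ → ℂ) t) atTop
      (𝓝 ((y : ℝ → ℂ) t)) := by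
    intro t ht
    have h3 := (tendsto_apply_sub h2 ht).add_const p
    have h4 : (y : ℝ → ℂ) (-T) = p := by simp [hydef]
    simpa only [h4, Function.comp_apply, hp, sub_add_cancel] using h3
  have h5 := tendsto_inner_pos (x := x ∘ φ) (fun n => hM _) (fun n => hp _) hpt g
  have h6 : inner ℂ g (pos y) = ∫ t in Icc (-T) T, inner ℂ (g t) ((y : ℝ → ℂ) t) := by
    rw [L2.inner_def]
    refine integral_congr_ae ?_
    filter_upwards [coeFn_pos y] with t ht
    rw [ht]
  rw [h6]
  exact h5

/-- The convex function `‖v‖ ^ 2 / 2` lies above its tangent at `vel y`, which is affine and so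
passes to the weak limit. -/
theorem norm_vel_sq_le_liminf {T : ℝ} {x : ℕ → H1Curve T} {y : H1Curve T}
    (h : WeaklyTendsto T x y) :
    ENNReal.ofReal (‖vel y‖ ^ 2 / 2) ≤
      liminf (fun n => ENNReal.ofReal (‖vel (x n)‖ ^ 2 / 2)) atTop := by
  have h1 := ((weaklyTendsto_iff x y).1 h).2 (vel y)
  have h2 : Tendsto (fun n => ENNReal.ofReal ((inner ℂ (vel y) (vel (x n)) : ℂ).re -
      ‖vel y‖ ^ 2 / 2)) atTop (𝓝 (ENNReal.ofReal (‖vel y‖ ^ 2 / 2))) := by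
    refine (ENNReal.continuous_ofReal.tendsto _).comp ?_
    have h3 := ((Complex.continuous_re.tendsto _).comp h1).sub_const (‖vel y‖ ^ 2 / 2)
    have h4 : (inner ℂ (vel y) (vel y) : ℂ).re - ‖vel y‖ ^ 2 / 2 = ‖vel y‖ ^ 2 / 2 := by
      rw [inner_self_eq_norm_sq_to_K]
      have : ((‖vel y‖ : ℂ) ^ 2).re = ‖vel y‖ ^ 2 := by
        rw [← Complex.ofReal_pow, Complex.ofReal_re]
      simp only [Complex.coe_algebraMap, this]
      ring
    rw [h4] at h3
    exact h3
  rw [← h2.liminf_eq]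
  refine liminf_le_liminf (Eventually.of_forall fun n => ENNReal.ofReal_le_ofReal ?_)
  have h3 : (inner ℂ (vel y) (vel (x n)) : ℂ).re ≤ ‖vel y‖ * ‖vel (x n)‖ :=
    (Complex.re_le_norm _).trans (norm_inner_le_norm _ _)
  nlinarith [sq_nonneg (‖vel y‖ - ‖vel (x n)‖)]

theorem le_liminf_add_ennreal (f g : ℕ → ℝ≥0∞) :
    liminf f atTop + liminf g atTop ≤ liminf (fun n => f n + g n) atTop := by
  simp only [liminf_eq_iSup_iInf_of_nat]
  rw [ENNReal.iSup_add_iSup_of_monotone]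
  · refine iSup_mono fun n => le_iInf₂ fun i hi => ?_
    exact add_le_add (iInf₂_le i hi) (iInf₂_le i hi)
  · exact fun a b hab => le_iInf₂ fun i hi => iInf₂_le i (hab.trans hi)
  · exact fun a b hab => le_iInf₂ fun i hi => iInf₂_le i (hab.trans hi)

/-- The action is weakly sequentially lower semicontinuous on curves with a common left end
point. -/
theorem action_le_of_weaklyTendsto {m α T : ℝ} (hT : 0 < T)
    {x : ℕ → H1Curve T} {y : H1Curve T} (h : WeaklyTendsto T x y) {p : ℂ}
    (hp : ∀ n, (x n : ℝ → ℂ) (-T) = p) {c : ℝ≥0∞}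
    (hc : Tendsto (fun n => action m α T (x n)) atTop (𝓝 c)) : action m α T y ≤ c := by
  have hu := h.tendstoUniformlyOn hT hp
  have hpot : ∫⁻ t in Icc (-T) T, potential m α ((y : ℝ → ℂ) t) ≤
      liminf (fun n => ∫⁻ t in Icc (-T) T, potential m α ((x n : ℝ → ℂ) t)) atTop := by
    refine le_trans (lintegral_mono_ae ?_) (lintegral_liminf_le'
      (fun n => aemeasurable_potential m α (x n)))
    filter_upwards [ae_restrict_mem measurableSet_Icc] with t ht
    exact (((continuous_potential m α).tendsto _).comp (hu.tendsto_at ht)).liminf_eq.ge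
  rw [action_eq, ← hc.liminf_eq]
  refine (add_le_add (norm_vel_sq_le_liminf h) hpot).trans ?_
  simp only [action_eq]
  exact le_liminf_add_ennreal _ _

/-! ### The class of curves -/

theorem continuousOn_curve {T : ℝ} (z : H1Curve T) : ContinuousOn (z : ℝ → ℂ) (Icc (-T) T) :=
  z.2.absCont.continuousOn.mono Icc_subset_uIcc

/-- A curve that is closer to a member of `GammaStar` than the origin belongs to `GammaStar`. -/
theorem mem_GammaStar_of_norm_sub_lt {m α T φm φp : ℝ} (hT : 0 < T) {x y : H1Curve T}
    (hx : x ∈ GammaStar m α T φm φp) (hl : (y : ℝ → ℂ) (-T) = (x : ℝ → ℂ) (-T))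
    (hr : (y : ℝ → ℂ) T = (x : ℝ → ℂ) T)
    (h : ∀ t ∈ Icc (-T) T, ‖(y : ℝ → ℂ) t - (x : ℝ → ℂ) t‖ < ‖(x : ℝ → ℂ) t‖) :
    y ∈ GammaStar m α T φm φp := by
  obtain ⟨hx0, hxl, hxr, θ, hθ, hθl, hθr, hθx⟩ := hx
  have hTT : -T ≤ T := by linarith
  -- The quotient `y / x` stays in the disc of radius `1` about `1`, where `arg` is continuous, and
  -- equals `1` at both ends. So `θ + arg (y / x)` is a continuous angle of `y` with the same end
  -- values.
  have hslit : ∀ t ∈ Icc (-T) T, (y : ℝ → ℂ) t / (x : ℝ → ℂ) t ∈ Complex.slitPlane := by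
    intro t ht
    rw [← add_sub_cancel (1 : ℂ) ((y : ℝ → ℂ) t / (x : ℝ → ℂ) t)]
    refine Complex.mem_slitPlane_of_norm_lt_one ?_
    rw [div_sub_one (hx0 t ht), norm_div, div_lt_one (norm_pos_iff.2 (hx0 t ht))]
    exact h t ht
  refine ⟨fun t ht h0 => ?_, hl.trans hxl, hr.trans hxr,
    fun t => θ t + Complex.arg ((y : ℝ → ℂ) t / (x : ℝ → ℂ) t), ?_, ?_, ?_, ?_⟩
  · have := h t ht
    rw [h0, zero_sub, norm_neg] at this
    exact lt_irrefl _ this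
  · refine hθ.add fun t ht => ?_
    exact ContinuousAt.comp_continuousWithinAt (f := fun t => (y : ℝ → ℂ) t / (x : ℝ → ℂ) t)
      (Complex.continuousAt_arg (hslit t ht))
      (((continuousOn_curve y).div (continuousOn_curve x) hx0) t ht)
  · simp only
    rw [hl, div_self (hx0 _ (left_mem_Icc.2 hTT)), Complex.arg_one, add_zero, hθl]
  · simp only
    rw [hr, div_self (hx0 _ (right_mem_Icc.2 hTT)), Complex.arg_one, add_zero, hθr]
  · intro t ht
    have h0 := hx0 t ht
    have hn : (‖(x : ℝ → ℂ) t‖ : ℂ) ≠ 0 := by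
      exact_mod_cast norm_ne_zero_iff.2 h0
    have e1 := Complex.norm_mul_exp_arg_mul_I ((y : ℝ → ℂ) t / (x : ℝ → ℂ) t)
    rw [norm_div, Complex.ofReal_div] at e1
    have e2 := hθx t ht
    push_cast
    rw [add_mul, Complex.exp_add]
    calc (y : ℝ → ℂ) t = (x : ℝ → ℂ) t * ((y : ℝ → ℂ) t / (x : ℝ → ℂ) t) := by field_simp
      _ = ((‖(x : ℝ → ℂ) t‖ : ℂ) * Complex.exp (θ t * Complex.I)) *
          ((‖(y : ℝ → ℂ) t‖ : ℂ) / (‖(x : ℝ → ℂ) t‖ : ℂ) *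
            Complex.exp (Complex.arg ((y : ℝ → ℂ) t / (x : ℝ → ℂ) t) * Complex.I)) := by
          rw [e1, ← e2]
      _ = _ := by field_simp

theorem GammaStar_subset_Gamma {m α T φm φp : ℝ} :
    GammaStar m α T φm φp ⊆ Gamma m α T φm φp := fun x hx =>
  ⟨fun _ => x, fun _ => hx, (weaklyTendsto_iff_dual _ _).2 fun _ => tendsto_const_nhds⟩

theorem exists_seq_of_mem_Gamma {m α T φm φp : ℝ} (hT : 0 < T) {y : H1Curve T}
    (hy : y ∈ Gamma m α T φm φp) :
    ∃ x : ℕ → H1Curve T, (∀ n, x n ∈ GammaStar m α T φm φp) ∧ WeaklyTendsto T x y ∧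
      TendstoUniformlyOn (fun n => (x n : ℝ → ℂ)) y atTop (Icc (-T) T) := by
  obtain ⟨x, hx, hxy⟩ := hy
  exact ⟨x, hx, hxy, hxy.tendstoUniformlyOn hT fun n => (hx n).2.1⟩

theorem apply_of_mem_Gamma {m α T φm φp : ℝ} (hT : 0 < T) {y : H1Curve T}
    (hy : y ∈ Gamma m α T φm φp) :
    (y : ℝ → ℂ) (-T) = xbar m α φm φp (-T) ∧ (y : ℝ → ℂ) T = xbar m α φm φp T := by
  obtain ⟨x, hx, -, hu⟩ := exists_seq_of_mem_Gamma hT hy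
  have hTT : -T ≤ T := by linarith
  constructor
  · have h1 := hu.tendsto_at (left_mem_Icc.2 hTT)
    simp only [fun n => (hx n).2.1] at h1
    exact tendsto_nhds_unique h1 tendsto_const_nhds
  · have h1 := hu.tendsto_at (right_mem_Icc.2 hTT)
    simp only [fun n => (hx n).2.2.1] at h1
    exact tendsto_nhds_unique h1 tendsto_const_nhds

/-- A curve in the weak closure may be perturbed away from its collisions. -/
theorem add_mem_Gamma {m α T φm φp : ℝ} (hT : 0 < T) {y z : H1Curve T}
    (hy : y ∈ Gamma m α T φm φp) (hl : (z : ℝ → ℂ) (-T) = 0) (hr : (z : ℝ → ℂ) T = 0) {δ : ℝ}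
    (hδ : 0 < δ)
    (hz : ∀ t ∈ Icc (-T) T, (z : ℝ → ℂ) t = 0 ∨ ‖(z : ℝ → ℂ) t‖ + δ ≤ ‖(y : ℝ → ℂ) t‖) :
    y + z ∈ Gamma m α T φm φp := by
  obtain ⟨x, hx, hw, hu⟩ := exists_seq_of_mem_Gamma hT hy
  -- On this tail `‖y - x n‖ < δ`, hence `‖z‖ < ‖x n‖` wherever `z ≠ 0`, and the translates `x n +
  -- z` stay in `GammaStar`.
  obtain ⟨N, hN⟩ := eventually_atTop.1 (Metric.tendstoUniformlyOn_iff.1 hu δ hδ)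
  refine ⟨fun n => x (n + N) + z, fun n => ?_, ?_⟩
  · refine mem_GammaStar_of_norm_sub_lt hT (hx (n + N)) (by simp [hl]) (by simp [hr]) ?_
    intro t ht
    simp only [Submodule.coe_add, Pi.add_apply, add_sub_cancel_left]
    rcases hz t ht with h0 | h0
    · rw [h0, norm_zero]
      exact norm_pos_iff.2 ((hx (n + N)).1 t ht)
    · have h1 := hN (n + N) (Nat.le_add_left _ _) t ht
      rw [dist_eq_norm] at h1
      have h2 := norm_le_norm_add_norm_sub' ((y : ℝ → ℂ) t) ((x (n + N) : ℝ → ℂ) t)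
      linarith
  · rw [weaklyTendsto_iff_dual] at hw ⊢
    intro l
    simp only [map_add]
    exact (((tendsto_add_atTop_iff_nat N).2 (hw l))).add_const _

theorem exists_norm_lower_bound {T : ℝ} (z : H1Curve T) {s : Set ℝ} (hs : IsCompact s)
    (hsT : s ⊆ Icc (-T) T) (h0 : ∀ t ∈ s, (z : ℝ → ℂ) t ≠ 0) :
    ∃ δ > 0, ∀ t ∈ s, δ ≤ ‖(z : ℝ → ℂ) t‖ := by
  rcases s.eq_empty_or_nonempty with rfl | hne
  · exact ⟨1, one_pos, by simp⟩
  obtain ⟨t, ht, hmin⟩ := hs.exists_isMinOn hne ((continuousOn_curve z).mono hsT).norm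
  exact ⟨_, norm_pos_iff.2 (h0 t ht), fun u hu => hmin hu⟩

/-- Collision-free curves in the weak closure belong to `GammaStar`. -/
theorem mem_GammaStar_of_mem_Gamma {m α T φm φp : ℝ} (hT : 0 < T) {y : H1Curve T}
    (hy : y ∈ Gamma m α T φm φp) (h0 : ∀ t ∈ Icc (-T) T, (y : ℝ → ℂ) t ≠ 0) :
    y ∈ GammaStar m α T φm φp := by
  obtain ⟨x, hx, hw, hu⟩ := exists_seq_of_mem_Gamma hT hy
  obtain ⟨δ, hδ, hδy⟩ := exists_norm_lower_bound y isCompact_Icc subset_rfl h0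
  -- Half of the lower bound suffices: `‖x N‖ > δ - δ / 2 = δ / 2 > ‖y - x N‖`.
  obtain ⟨N, hN⟩ := (Metric.tendstoUniformlyOn_iff.1 hu (δ / 2) (by linarith)).exists
  have he := apply_of_mem_Gamma hT hy
  refine mem_GammaStar_of_norm_sub_lt hT (hx N) (he.1.trans (hx N).2.1.symm)
    (he.2.trans (hx N).2.2.1.symm) fun t ht => ?_
  have h1 := hN t ht
  rw [dist_eq_norm] at h1
  have h2 := norm_le_norm_add_norm_sub' ((y : ℝ → ℂ) t) ((x N : ℝ → ℂ) t)
  linarith [hδy t ht]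

/-! ### The lower bound for curves with collisions -/

/-- The Lagrangian along a curve. -/
def lagrangian (m α : ℝ) (x : ℝ → ℂ) (t : ℝ) : ℝ≥0∞ :=
  ENNReal.ofReal (‖deriv x t‖ ^ 2 / 2) + potential m α (x t)

theorem action_eq_lintegral (m α T : ℝ) (x : ℝ → ℂ) :
    action m α T x = ∫⁻ t in Icc (-T) T, lagrangian m α x t := rfl

theorem potential_eq_ofReal {m α : ℝ} {z : ℂ} (hz : z ≠ 0) :
    potential m α z = ENNReal.ofReal (m / α / ‖z‖ ^ α) := by
  have hpos : 0 < ‖z‖ := norm_pos_iff.2 hz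
  rw [potential, ENNReal.ofReal_div_of_pos (Real.rpow_pos_of_pos hpos _),
    ← ENNReal.ofReal_rpow_of_pos hpos, ofReal_norm]

/-- The Jacobi length, at zero energy, of the radial segment from the origin to radius `r`. -/
def jacobi (m α r : ℝ) : ℝ := √(2 * m / α) / (1 - α / 2) * r ^ (1 - α / 2)

theorem jacobi_zero {m α : ℝ} (hα2 : α < 2) : jacobi m α 0 = 0 := by
  rw [jacobi, Real.zero_rpow (by linarith), mul_zero]

theorem jacobi_nonneg {m α r : ℝ} (hα2 : α < 2) (hr : 0 ≤ r) : 0 ≤ jacobi m α r := by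
  have : 0 < 1 - α / 2 := by linarith
  unfold jacobi
  positivity

theorem continuous_jacobi (m : ℝ) {α : ℝ} (hα2 : α < 2) : Continuous (jacobi m α) := by
  unfold jacobi
  exact continuous_const.mul (Real.continuous_rpow_const (by linarith))

theorem hasDerivAt_jacobi (m : ℝ) {α r : ℝ} (hα2 : α < 2) (hr : 0 < r) :
    HasDerivAt (jacobi m α) (√(2 * m / α) * r ^ (-(α / 2))) r := by
  have h := (Real.hasDerivAt_rpow_const (p := 1 - α / 2) (Or.inl hr.ne')).const_mul
    (√(2 * m / α) / (1 - α / 2))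
  have h0 : 1 - α / 2 ≠ 0 := by linarith
  have e : √(2 * m / α) * r ^ (-(α / 2)) =
      √(2 * m / α) / (1 - α / 2) * ((1 - α / 2) * r ^ (1 - α / 2 - 1)) := by
    rw [show 1 - α / 2 - 1 = -(α / 2) by ring, ← mul_assoc, div_mul_cancel₀ _ h0]
  rw [e]
  exact h

/-- With `U` the potential term, the difference of the two sides is half the square of `w - √(2U)`;
equality is the zero-energy relation. -/
theorem speed_le_lagrangian {m α r w : ℝ} (hm : 0 < m) (hα : 0 < α) (hr : 0 < r) :
    √(2 * m / α) * r ^ (-(α / 2)) * w ≤ w ^ 2 / 2 + m / α / r ^ α := by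
  have h1 : (√(2 * m / α)) ^ 2 = 2 * m / α := Real.sq_sqrt (by positivity)
  have h2 : (r ^ (-(α / 2))) ^ 2 = (r ^ α)⁻¹ := by
    rw [← Real.rpow_natCast, ← Real.rpow_mul hr.le, ← Real.rpow_neg hr.le]
    congr 1
    push_cast; ring
  have h3 : (√(2 * m / α) * r ^ (-(α / 2))) ^ 2 = 2 * (m / α / r ^ α) := by
    rw [mul_pow, h1, h2]
    field_simp
  nlinarith [sq_nonneg (w - √(2 * m / α) * r ^ (-(α / 2)))]

/-- The radius changes no faster than the speed `‖deriv f‖`, so `speed_le_lagrangian` bounds the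
derivative of `jacobi m α ‖f‖` by the Lagrangian. -/
theorem abs_jacobi_sub_le_lintegral {m α : ℝ} (hm : 0 < m) (hα : 0 < α) (hα2 : α < 2)
    {f : ℝ → ℂ} {a b : ℝ} (hab : a ≤ b) (hf : AbsolutelyContinuousOnInterval f a b)
    (h0 : ∀ t ∈ Icc a b, f t ≠ 0) :
    ENNReal.ofReal |jacobi m α ‖f b‖ - jacobi m α ‖f a‖| ≤
      ∫⁻ t in Ioc a b, lagrangian m α f t := by
  have hn : AbsolutelyContinuousOnInterval (fun t => ‖f t‖) a b :=
    absCont_comp_lipschitz (s := univ) hf lipschitzWith_one_norm.lipschitzOnWith (mapsTo_univ _ _)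
  have hcont := hn.continuousOn
  rw [uIcc_of_le hab] at hcont
  obtain ⟨s, hs, hmin⟩ := isCompact_Icc.exists_isMinOn (nonempty_Icc.2 hab) hcont
  obtain ⟨u, hu, hmax⟩ := isCompact_Icc.exists_isMaxOn (nonempty_Icc.2 hab) hcont
  have hpos : 0 < ‖f s‖ := norm_pos_iff.2 (h0 s hs)
  -- The exponent `1 - α / 2` is below `1`, so `jacobi` is Lipschitz only away from the origin; this
  -- is where the absence of collisions enters.
  obtain ⟨K, hK⟩ : ∃ K, LipschitzOnWith K (jacobi m α) (Icc ‖f s‖ ‖f u‖) := by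
    refine ContDiffOn.exists_lipschitzOnWith (n := 1) (fun r hr => ?_) one_ne_zero
      (convex_Icc _ _) isCompact_Icc
    refine (contDiffAt_const.mul ?_).contDiffWithinAt
    exact Real.contDiffAt_rpow_const_of_ne (hpos.trans_le hr.1).ne'
  have hg : AbsolutelyContinuousOnInterval (fun t => jacobi m α ‖f t‖) a b := by
    refine absCont_comp_lipschitz hn hK fun t ht => ?_
    rw [uIcc_of_le hab] at ht
    exact ⟨hmin ht, hmax ht⟩
  rw [← hg.integral_deriv_eq_sub, intervalIntegral.integral_of_le hab, ← Real.norm_eq_abs,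
    ofReal_norm]
  refine (enorm_integral_le_lintegral_enorm _).trans (lintegral_mono_ae ?_)
  refine (ae_restrict_iff' measurableSet_Ioc).2 ?_
  have hdf : ∀ᵐ t : ℝ, t ∈ uIcc a b → DifferentiableAt ℝ f t := by
    have h := hf.boundedVariationOn.locallyBoundedVariationOn.ae_differentiableWithinAt_of_mem
    have h1 : ∀ᵐ t : ℝ, t ≠ a := by simp [ae_iff]
    have h2 : ∀ᵐ t : ℝ, t ≠ b := by simp [ae_iff]
    filter_upwards [h, h1, h2] with t ht ha hb hmem
    rw [uIcc_of_le hab] at hmem ht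
    exact (ht hmem).differentiableAt
      (Icc_mem_nhds (lt_of_le_of_ne hmem.1 (Ne.symm ha)) (lt_of_le_of_ne hmem.2 hb))
  filter_upwards [hdf] with t hd ht
  have htI := Ioc_subset_Icc_self ht
  have hd' := (hd (uIcc_of_le hab ▸ htI)).hasDerivAt
  have hr : 0 < ‖f t‖ := norm_pos_iff.2 (h0 t htI)
  have hnd : DifferentiableAt ℝ (fun t => ‖f t‖) t := hd'.differentiableAt.norm ℝ (h0 t htI)
  have hjd : deriv (fun t => jacobi m α ‖f t‖) t =
      √(2 * m / α) * ‖f t‖ ^ (-(α / 2)) * deriv (fun t => ‖f t‖) t :=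
    (HasDerivAt.comp (h := fun t => ‖f t‖) t (hasDerivAt_jacobi m hα2 hr) hnd.hasDerivAt).deriv
  have hnl : |deriv (fun t => ‖f t‖) t| ≤ ‖deriv f t‖ := by
    have h1 : HasDerivAt (fun t => ‖f t‖ ^ 2) (2 * ‖f t‖ * deriv (fun t => ‖f t‖) t) t := by
      have h := hnd.hasDerivAt.fun_pow 2
      simp only [Nat.cast_ofNat, Nat.add_one_sub_one, pow_one] at h
      exact h
    have h2 := h1.unique hd'.norm_sq
    have h3 : ‖f t‖ * deriv (fun t => ‖f t‖) t = inner ℝ (f t) (deriv f t) := by linarith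
    have h4 := abs_real_inner_le_norm (f t) (deriv f t)
    rw [← h3, abs_mul, abs_of_pos hr] at h4
    exact le_of_mul_le_mul_left h4 hr
  rw [lagrangian, potential_eq_ofReal (h0 t htI), ← ENNReal.ofReal_add (by positivity)
    (by positivity), hjd, ← ofReal_norm]
  refine ENNReal.ofReal_le_ofReal ?_
  rw [norm_mul, Real.norm_of_nonneg (by positivity), Real.norm_eq_abs]
  refine le_trans ?_ (speed_le_lagrangian hm hα hr)
  gcongr

/-- The collision-free estimate on `[c, b]`, with `c` tending to the collision time. Absolute
continuity is asked only away from the collision, so that `xbar` qualifies without being shown to be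
in `H¹`. -/
theorem jacobi_le_lintegral_right {m α : ℝ} (hm : 0 < m) (hα : 0 < α) (hα2 : α < 2)
    {f : ℝ → ℂ} {a b : ℝ} (hab : a < b)
    (hf : ∀ c ∈ Ioo a b, AbsolutelyContinuousOnInterval f c b)
    (h0 : ∀ t ∈ Ioc a b, f t ≠ 0) (hlim : Tendsto f (𝓝[>] a) (𝓝 0)) :
    ENNReal.ofReal (jacobi m α ‖f b‖) ≤ ∫⁻ t in Ioc a b, lagrangian m α f t := by
  have h1 : Tendsto (fun c => ENNReal.ofReal |jacobi m α ‖f b‖ - jacobi m α ‖f c‖|) (𝓝[>] a)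
      (𝓝 (ENNReal.ofReal (jacobi m α ‖f b‖))) := by
    refine (ENNReal.continuous_ofReal.tendsto _).comp ?_
    have h2 := ((((continuous_jacobi m hα2).tendsto _).comp hlim.norm).const_sub
      (jacobi m α ‖f b‖)).abs
    simpa [jacobi_zero hα2, abs_of_nonneg (jacobi_nonneg hα2 (norm_nonneg _))] using h2
  refine le_of_tendsto h1 ?_
  filter_upwards [Ioo_mem_nhdsGT hab] with c hc
  refine (abs_jacobi_sub_le_lintegral hm hα hα2 hc.2.le (hf c hc) fun t ht =>
    h0 t ⟨hc.1.trans_le ht.1, ht.2⟩).trans ?_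
  exact lintegral_mono_set (Ioc_subset_Ioc_left hc.1.le)

theorem jacobi_le_lintegral_left {m α : ℝ} (hm : 0 < m) (hα : 0 < α) (hα2 : α < 2)
    {f : ℝ → ℂ} {a b : ℝ} (hab : a < b)
    (hf : ∀ c ∈ Ioo a b, AbsolutelyContinuousOnInterval f a c)
    (h0 : ∀ t ∈ Ico a b, f t ≠ 0) (hlim : Tendsto f (𝓝[<] b) (𝓝 0)) :
    ENNReal.ofReal (jacobi m α ‖f a‖) ≤ ∫⁻ t in Ioc a b, lagrangian m α f t := by
  have h1 : Tendsto (fun c => ENNReal.ofReal |jacobi m α ‖f c‖ - jacobi m α ‖f a‖|) (𝓝[<] b)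
      (𝓝 (ENNReal.ofReal (jacobi m α ‖f a‖))) := by
    refine (ENNReal.continuous_ofReal.tendsto _).comp ?_
    have h2 := ((((continuous_jacobi m hα2).tendsto _).comp hlim.norm).sub_const
      (jacobi m α ‖f a‖)).abs
    simpa [jacobi_zero hα2, abs_of_nonneg (jacobi_nonneg hα2 (norm_nonneg _))] using h2
  refine le_of_tendsto h1 ?_
  filter_upwards [Ioo_mem_nhdsLT hab] with c hc
  refine (abs_jacobi_sub_le_lintegral hm hα hα2 hc.1.le (hf c hc) fun t ht =>
    h0 t ⟨ht.1, ht.2.trans_lt hc.2⟩).trans ?_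
  exact lintegral_mono_set (Ioc_subset_Ioc_right hc.2.le)

theorem lintegral_add_lintegral_le_action {m α T t₁ t₂ : ℝ} {x : ℝ → ℂ} (h₁ : -T ≤ t₁)
    (h₁₂ : t₁ ≤ t₂) (h₂ : t₂ ≤ T) :
    (∫⁻ t in Ioc (-T) t₁, lagrangian m α x t) + ∫⁻ t in Ioc t₂ T, lagrangian m α x t ≤
      action m α T x := by
  rw [← lintegral_union measurableSet_Ioc, action_eq_lintegral]
  · refine lintegral_mono_set (union_subset (fun t ht => ⟨ht.1.le, ?_⟩) fun t ht => ⟨?_, ht.2⟩)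
    · linarith [ht.2]
    · linarith [ht.1]
  · refine disjoint_left.2 fun t ht ht' => ?_
    linarith [ht.2, ht'.1]

/-! ### The parabolic radius and the action of curves with collisions -/

/-- The radius of the parabolic solution at time `t`. -/
def rbar (m α t : ℝ) : ℝ := (mu m α * t) ^ (2 / (α + 2))

theorem mu_pos {m α : ℝ} (hm : 0 < m) (hα : 0 < α) : 0 < mu m α := by
  unfold mu; positivity

theorem rbar_pos {m α t : ℝ} (hm : 0 < m) (hα : 0 < α) (ht : 0 < t) : 0 < rbar m α t :=
  Real.rpow_pos_of_pos (mul_pos (mu_pos hm hα) ht) _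

theorem xbar_of_pos {m α φm φp t : ℝ} (ht : 0 < t) :
    xbar m α φm φp t = (rbar m α t : ℂ) * Complex.exp (φp * Complex.I) := by
  rw [xbar, rbar, abs_of_pos ht, if_pos ht.le]

theorem xbar_of_neg {m α φm φp t : ℝ} (ht : t < 0) :
    xbar m α φm φp t = (rbar m α (-t) : ℂ) * Complex.exp (φm * Complex.I) := by
  rw [xbar, rbar, abs_of_neg ht, if_neg (not_le.2 ht)]

theorem norm_xbar {m α φm φp t : ℝ} (hm : 0 < m) (hα : 0 < α) :
    ‖xbar m α φm φp t‖ = rbar m α |t| := by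
  rw [xbar, norm_mul, Complex.norm_exp_ofReal_mul_I, mul_one, Complex.norm_real, rbar,
    Real.norm_of_nonneg]
  have := (mu_pos hm hα).le
  positivity

/-- A curve with a collision has at least the action of the collision-ejection solution. -/
theorem two_jacobi_le_action {m α T φm φp : ℝ} (hm : 0 < m) (hα : 0 < α) (hα2 : α < 2)
    (hT : 0 < T) {y : H1Curve T} (hl : (y : ℝ → ℂ) (-T) = xbar m α φm φp (-T))
    (hr : (y : ℝ → ℂ) T = xbar m α φm φp T) {t₀ : ℝ} (ht₀ : t₀ ∈ Icc (-T) T)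
    (hy : (y : ℝ → ℂ) t₀ = 0) :
    ENNReal.ofReal (2 * jacobi m α (rbar m α T)) ≤ action m α T y := by
  have hc := continuousOn_curve y
  set Z : Set ℝ := {t ∈ Icc (-T) T | (y : ℝ → ℂ) t = 0} with hZ
  have hZc : IsCompact Z := by
    refine isCompact_Icc.of_isClosed_subset ?_ (sep_subset _ _)
    exact hc.preimage_isClosed_of_isClosed isClosed_Icc isClosed_singleton
  have hZn : Z.Nonempty := ⟨t₀, ht₀, hy⟩
  -- Only the arcs before the first and after the last collision are counted; the action in between
  -- is dropped.
  have h1 := hZc.sInf_mem hZn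
  have h2 := hZc.sSup_mem hZn
  have h12 : sInf Z ≤ sSup Z := csInf_le_csSup hZn hZc.bddBelow hZc.bddAbove
  set t₁ := sInf Z
  set t₂ := sSup Z
  have hpos := rbar_pos hm hα hT
  have hnl : ‖(y : ℝ → ℂ) (-T)‖ = rbar m α T := by
    rw [hl, norm_xbar hm hα, abs_neg, abs_of_pos hT]
  have hnr : ‖(y : ℝ → ℂ) T‖ = rbar m α T := by
    rw [hr, norm_xbar hm hα, abs_of_pos hT]
  have hlt1 : -T < t₁ := lt_of_le_of_ne h1.1.1 fun h => by
    rw [h, h1.2, norm_zero] at hnl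
    exact hpos.ne hnl
  have hlt2 : t₂ < T := lt_of_le_of_ne h2.1.2 fun h => by
    have h3 : (y : ℝ → ℂ) T = 0 := (congrArg (y : ℝ → ℂ) h).symm.trans h2.2
    rw [h3, norm_zero] at hnr
    exact hpos.ne hnr
  have hac : ∀ a b, a ∈ Icc (-T) T → b ∈ Icc (-T) T →
      AbsolutelyContinuousOnInterval (y : ℝ → ℂ) a b := fun a b ha hb =>
    y.2.absCont.mono ((uIcc_subset_Icc ha hb).trans Icc_subset_uIcc)
  refine le_trans ?_ (lintegral_add_lintegral_le_action h1.1.1 h12 h2.1.2)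
  rw [two_mul, ENNReal.ofReal_add (jacobi_nonneg hα2 hpos.le) (jacobi_nonneg hα2 hpos.le)]
  refine add_le_add ?_ ?_
  · rw [← hnl]
    refine jacobi_le_lintegral_left hm hα hα2 hlt1 (fun c hc => hac _ _ ⟨le_rfl, by linarith⟩
      ⟨hc.1.le, hc.2.le.trans h1.1.2⟩) (fun t ht h0 => ?_) ?_
    · exact absurd (csInf_le hZc.bddBelow ⟨⟨ht.1, ht.2.le.trans h1.1.2⟩, h0⟩) (not_le.2 ht.2)
    · have h := (hc t₁ h1.1).tendsto
      rw [h1.2] at h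
      refine h.mono_left ?_
      rw [← nhdsWithin_Ioo_eq_nhdsLT hlt1]
      exact nhdsWithin_mono _ fun t ht => ⟨ht.1.le, ht.2.le.trans h1.1.2⟩
  · rw [← hnr]
    refine jacobi_le_lintegral_right hm hα hα2 hlt2 (fun c hc => hac _ _
      ⟨h2.1.1.trans hc.1.le, hc.2.le⟩ ⟨by linarith, le_rfl⟩) (fun t ht h0 => ?_) ?_
    · exact absurd (le_csSup hZc.bddAbove ⟨⟨h2.1.1.trans ht.1.le, ht.2⟩, h0⟩) (not_le.2 ht.1)
    · have h := (hc t₂ h2.1).tendsto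
      rw [h2.2] at h
      refine h.mono_left ?_
      rw [← nhdsWithin_Ioo_eq_nhdsGT hlt2]
      exact nhdsWithin_mono _ fun t ht => ⟨h2.1.1.trans ht.1.le, ht.2.le⟩

theorem contDiffOn_rbar {m α : ℝ} (hm : 0 < m) (hα : 0 < α) :
    ContDiffOn ℝ 1 (rbar m α) (Ioi 0) := fun t ht => by
  refine ContDiffAt.contDiffWithinAt ?_
  exact (contDiffAt_const.mul contDiffAt_id).rpow_const_of_ne
    (mul_pos (mu_pos hm hα) ht).ne'

/-- Equality holds, the motion being radial at zero energy, but the strict comparison with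
minimizers needs only this direction. -/
theorem two_jacobi_le_action_xbar {m α T φm φp : ℝ} (hm : 0 < m) (hα : 0 < α) (hα2 : α < 2)
    (hT : 0 < T) :
    ENNReal.ofReal (2 * jacobi m α (rbar m α T)) ≤ action m α T (xbar m α φm φp) := by
  have hpos := rbar_pos hm hα hT
  have hp : 0 < 2 / (α + 2) := by positivity
  have hn : Tendsto (xbar m α φm φp) (𝓝 0) (𝓝 0) := by
    rw [tendsto_zero_iff_norm_tendsto_zero]
    simp only [norm_xbar hm hα, rbar]
    have : Continuous fun t : ℝ => (mu m α * |t|) ^ (2 / (α + 2)) :=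
      (Real.continuous_rpow_const hp.le).comp (by fun_prop)
    have h := this.tendsto 0
    simpa [Real.zero_rpow hp.ne'] using h
  have hne : ∀ t, t ≠ 0 → xbar m α φm φp t ≠ 0 := fun t ht => by
    rw [← norm_pos_iff, norm_xbar hm hα]
    exact rbar_pos hm hα (abs_pos.2 ht)
  refine le_trans ?_ (lintegral_add_lintegral_le_action (neg_nonpos.2 hT.le) (le_refl 0) hT.le)
  rw [two_mul, ENNReal.ofReal_add (jacobi_nonneg hα2 hpos.le) (jacobi_nonneg hα2 hpos.le)]
  refine add_le_add ?_ ?_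
  · have e : rbar m α T = ‖xbar m α φm φp (-T)‖ := by
      rw [norm_xbar hm hα, abs_neg, abs_of_pos hT]
    rw [e]
    refine jacobi_le_lintegral_left hm hα hα2 (neg_neg_iff_pos.2 hT) (fun c hc => ?_)
      (fun t ht => hne t ht.2.ne) (hn.mono_left nhdsWithin_le_nhds)
    have h1 : ContDiffOn ℝ 1 (fun t : ℝ => (rbar m α (-t) : ℂ) * Complex.exp (φm * Complex.I))
        (uIcc (-T) c) := by
      refine ContDiffOn.mul (Complex.ofRealCLM.contDiff.comp_contDiffOn
        ((contDiffOn_rbar hm hα).comp contDiff_neg.contDiffOn fun t ht => ?_)) contDiffOn_const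
      rw [uIcc_of_le hc.1.le] at ht
      exact neg_pos.2 (ht.2.trans_lt hc.2)
    refine absCont_congr h1.absolutelyContinuousOnInterval fun t ht => ?_
    rw [uIcc_of_le hc.1.le] at ht
    exact (xbar_of_neg (ht.2.trans_lt hc.2)).symm
  · have e : rbar m α T = ‖xbar m α φm φp T‖ := by
      rw [norm_xbar hm hα, abs_of_pos hT]
    rw [e]
    refine jacobi_le_lintegral_right hm hα hα2 hT (fun c hc => ?_)
      (fun t ht => hne t ht.1.ne') (hn.mono_left nhdsWithin_le_nhds)
    have h1 : ContDiffOn ℝ 1 (fun t : ℝ => (rbar m α t : ℂ) * Complex.exp (φp * Complex.I))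
        (uIcc c T) := by
      refine ContDiffOn.mul (Complex.ofRealCLM.contDiff.comp_contDiffOn
        ((contDiffOn_rbar hm hα).mono fun t ht => ?_)) contDiffOn_const
      rw [uIcc_of_le hc.2.le] at ht
      exact hc.1.trans_le ht.1
    refine absCont_congr h1.absolutelyContinuousOnInterval fun t ht => ?_
    rw [uIcc_of_le hc.2.le] at ht
    exact (xbar_of_pos (hc.1.trans_le ht.1)).symm

/-! ### Comparison curves -/

/-- The curve with polar coordinates `r` and `θ`. -/
def polar (r θ : ℝ → ℝ) (t : ℝ) : ℂ := (r t : ℂ) * Complex.exp ((θ t : ℂ) * Complex.I)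

theorem hasDerivAt_polar {r θ : ℝ → ℝ} {r' θ' t : ℝ} (hr : HasDerivAt r r' t)
    (hθ : HasDerivAt θ θ' t) :
    HasDerivAt (polar r θ)
      (((r' : ℂ) + ((r t * θ' : ℝ) : ℂ) * Complex.I) * Complex.exp ((θ t : ℂ) * Complex.I)) t := by
  have h := hr.ofReal_comp.mul (((hθ.ofReal_comp).mul_const Complex.I).cexp)
  refine h.congr_deriv ?_
  push_cast
  ring

theorem norm_polar {r θ : ℝ → ℝ} {t : ℝ} (hr : 0 ≤ r t) : ‖polar r θ t‖ = r t := by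
  rw [polar, norm_mul, Complex.norm_exp_ofReal_mul_I, mul_one, Complex.norm_real,
    Real.norm_of_nonneg hr]

theorem lagrangian_polar {m α : ℝ} (hm : 0 < m) (hα : 0 < α) {r θ : ℝ → ℝ} {r' θ' t : ℝ}
    (hr : HasDerivAt r r' t) (hθ : HasDerivAt θ θ' t) (hpos : 0 < r t) :
    lagrangian m α (polar r θ) t =
      ENNReal.ofReal ((r' ^ 2 + (r t * θ') ^ 2) / 2 + m / α / r t ^ α) := by
  have hn : polar r θ t ≠ 0 := by
    rw [← norm_pos_iff, norm_polar hpos.le]; exact hpos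
  rw [lagrangian, (hasDerivAt_polar hr hθ).deriv, potential_eq_ofReal hn, norm_polar hpos.le,
    norm_mul, Complex.norm_exp_ofReal_mul_I, mul_one, ← Complex.normSq_eq_norm_sq,
    Complex.normSq_add_mul_I, ENNReal.ofReal_add (by positivity) (by positivity)]

/-- Actions of comparison curves are computed from an explicit primitive; nonnegativity of the
derivative supplies integrability. -/
theorem lintegral_ofReal_deriv {Q q : ℝ → ℝ} {a b : ℝ} (hab : a ≤ b)
    (hQ : ContinuousOn Q (Icc a b)) (hd : ∀ t ∈ Ioo a b, HasDerivAt Q (q t) t)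
    (hq : ∀ t ∈ Ioo a b, 0 ≤ q t) :
    ∫⁻ t in Ioo a b, ENNReal.ofReal (q t) = ENNReal.ofReal (Q b - Q a) := by
  have hi : IntegrableOn q (Ioc a b) :=
    intervalIntegral.integrableOn_deriv_of_nonneg hQ hd hq
  rw [← intervalIntegral.integral_eq_sub_of_hasDerivAt_of_le hab hQ hd
    ((intervalIntegrable_iff_integrableOn_Ioc_of_le hab).2 hi),
    intervalIntegral.integral_of_le hab, integral_Ioc_eq_integral_Ioo,
    ofReal_integral_eq_lintegral_ofReal (hi.mono_set Ioo_subset_Ioc_self)]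
  exact (ae_restrict_iff' measurableSet_Ioo).2 (ae_of_all _ hq)

/-- Here `Q` is the action accumulated along an arc given in polar coordinates. -/
theorem lintegral_lagrangian_polar {m α : ℝ} (hm : 0 < m) (hα : 0 < α) {x : ℝ → ℂ}
    {r θ r' θ' Q : ℝ → ℝ} {a b : ℝ} (hab : a ≤ b) (hx : ∀ t ∈ Ioo a b, x t = polar r θ t)
    (hpos : ∀ t ∈ Ioo a b, 0 < r t)
    (hr : ∀ t ∈ Ioo a b, HasDerivAt r (r' t) t) (hθ : ∀ t ∈ Ioo a b, HasDerivAt θ (θ' t) t)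
    (hQ : ContinuousOn Q (Icc a b))
    (hQd : ∀ t ∈ Ioo a b, HasDerivAt Q
      (((r' t) ^ 2 + (r t * θ' t) ^ 2) / 2 + m / α / r t ^ α) t) :
    (∫⁻ t in Ioo a b, lagrangian m α x t = ENNReal.ofReal (Q b - Q a)) ∧
      ∀ t ∈ Ioo a b, DifferentiableAt ℝ x t := by
  have hev : ∀ t ∈ Ioo a b, x =ᶠ[𝓝 t] polar r θ := fun t ht => by
    filter_upwards [Ioo_mem_nhds ht.1 ht.2] with u hu using hx u hu
  refine ⟨?_, fun t ht => (hasDerivAt_polar (hr t ht) (hθ t ht)).differentiableAt.congr_of_eventuallyEq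
    (hev t ht)⟩
  rw [← lintegral_ofReal_deriv hab hQ hQd fun t ht => by have := hpos t ht; positivity]
  refine setLIntegral_congr_fun measurableSet_Ioo fun t ht => ?_
  rw [← lagrangian_polar hm hα (hr t ht) (hθ t ht) (hpos t ht), lagrangian, lagrangian,
    (hev t ht).deriv_eq, hx t ht]

/-- This is the zero-energy relation `r' = √(2U)`; the constant `mu` is chosen so that `mu * (2 / (α
+ 2)) = √(2m / α)`. -/
theorem hasDerivAt_rbar {m α t : ℝ} (hm : 0 < m) (hα : 0 < α) (ht : 0 < t) :
    HasDerivAt (rbar m α) (√(2 * m / α) * rbar m α t ^ (-(α / 2))) t := by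
  have hμ := mu_pos hm hα
  have h1 : HasDerivAt (fun t => mu m α * t) (mu m α) t := by
    simpa using (hasDerivAt_id t).const_mul (mu m α)
  have h2 := h1.rpow_const (p := 2 / (α + 2)) (Or.inl (mul_pos hμ ht).ne')
  refine h2.congr_deriv ?_
  rw [rbar, ← Real.rpow_mul (mul_pos hμ ht).le]
  have e1 : 2 / (α + 2) - 1 = 2 / (α + 2) * -(α / 2) := by field_simp; ring
  have e2 : mu m α * (2 / (α + 2)) = √(2 * m / α) := by
    have e3 : √(2 * m / α) = 2 * √(m / (2 * α)) := by
      rw [show 2 * m / α = 2 ^ 2 * (m / (2 * α)) by field_simp, Real.sqrt_mul (by positivity),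
        Real.sqrt_sq (by norm_num)]
    rw [e3, mu, ← Real.sqrt_eq_rpow]
    field_simp
  rw [e1, e2]

theorem continuous_rbar {m α : ℝ} (hα : 0 < α) : Continuous (rbar m α) := by
  unfold rbar
  exact (Real.continuous_rpow_const (by positivity)).comp (continuous_const.mul continuous_id)

/-- The time-stretched radial solution: the radius, its derivative and the accumulated action. -/
theorem hasDerivAt_stretched {m α : ℝ} (hm : 0 < m) (hα : 0 < α) (hα2 : α < 2) {l c ε t : ℝ}
    (hl : 0 < l) (hε : ε ^ 2 = 1) (hw : 0 < ε * t / l + c) :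
    HasDerivAt (fun t => rbar m α (ε * t / l + c))
        (√(2 * m / α) * rbar m α (ε * t / l + c) ^ (-(α / 2)) * (ε / l)) t ∧
      HasDerivAt (fun t => ε * ((l + 1 / l) / 2) * jacobi m α (rbar m α (ε * t / l + c)))
        (((√(2 * m / α) * rbar m α (ε * t / l + c) ^ (-(α / 2)) * (ε / l)) ^ 2 +
          (rbar m α (ε * t / l + c) * 0) ^ 2) / 2 + m / α / rbar m α (ε * t / l + c) ^ α) t := by
  have h1 : HasDerivAt (fun t => ε * t / l + c) (ε / l) t := by
    simpa using (((hasDerivAt_id t).const_mul ε).div_const l).add_const c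
  have h2 : HasDerivAt (fun t => rbar m α (ε * t / l + c))
        (√(2 * m / α) * rbar m α (ε * t / l + c) ^ (-(α / 2)) * (ε / l)) t :=
    HasDerivAt.comp (h := fun t => ε * t / l + c) t (hasDerivAt_rbar hm hα hw) h1
  have hr := rbar_pos hm hα hw
  refine ⟨h2, ?_⟩
  -- At zero energy the kinetic term equals `U` before stretching and `U / l ^ 2` after it, while
  -- Jacobi length accrues at rate `2U / l`. The ratio of `U / l ^ 2 + U` to this rate is `(l + 1 /
  -- l) / 2`. The sign `ε` is the direction of motion.
  have h3 := (HasDerivAt.comp (h := fun t => rbar m α (ε * t / l + c)) t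
    (hasDerivAt_jacobi m hα2 hr) h2).const_mul (ε * ((l + 1 / l) / 2))
  refine h3.congr_deriv ?_
  have e1 : (√(2 * m / α)) ^ 2 = 2 * m / α := Real.sq_sqrt (by positivity)
  have e2 : (rbar m α (ε * t / l + c) ^ (-(α / 2))) ^ 2 = (rbar m α (ε * t / l + c) ^ α)⁻¹ := by
    rw [← Real.rpow_natCast, ← Real.rpow_mul hr.le, ← Real.rpow_neg hr.le]
    congr 1
    push_cast; ring
  generalize √(2 * m / α) = k at *
  generalize rbar m α (ε * t / l + c) ^ (-(α / 2)) = v at *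
  rw [div_eq_mul_inv (m / α), ← e2]
  calc ε * ((l + 1 / l) / 2) * (k * v * (k * v * (ε / l)))
      = ε ^ 2 * k ^ 2 * v ^ 2 * ((l + 1 / l) / 2 / l) := by ring
    _ = (2 * m / α) * v ^ 2 * ((l + 1 / l) / 2 / l) := by rw [hε, e1]; ring
    _ = m / α * v ^ 2 * (1 / l ^ 2) + m / α * v ^ 2 := by field_simp; ring
    _ = (k ^ 2 * ε ^ 2 / 2) * v ^ 2 * (1 / l ^ 2) + m / α * v ^ 2 := by rw [hε, e1]; ring
    _ = _ := by ring

theorem action_le_add_add {m α T : ℝ} (τ : ℝ) {x : ℝ → ℂ} :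
    action m α T x ≤ ((∫⁻ t in Ioo (-T) (-τ), lagrangian m α x t) +
      ∫⁻ t in Ioo (-τ) τ, lagrangian m α x t) + ∫⁻ t in Ioo τ T, lagrangian m α x t := by
  rw [action_eq_lintegral, setLIntegral_congr Ioc_ae_eq_Icc.symm,
    setLIntegral_congr (Ioo_ae_eq_Ioc (a := -T) (b := -τ)),
    setLIntegral_congr (Ioo_ae_eq_Ioc (a := -τ) (b := τ)),
    setLIntegral_congr (Ioo_ae_eq_Ioc (a := τ) (b := T))]
  refine le_trans (lintegral_mono_set ?_) ((lintegral_union_le _ _ _).trans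
    (add_le_add_left (lintegral_union_le _ _ _) _))
  intro t ht
  rcases le_or_gt t (-τ) with h1 | h1
  · exact Or.inl (Or.inl ⟨ht.1, h1⟩)
  rcases le_or_gt t τ with h2 | h2
  · exact Or.inl (Or.inr ⟨h1, h2⟩)
  · exact Or.inr ⟨h2, ht.2⟩

/-- Joins a collision-free arc on `[-τ, τ]` to the radial solutions, stretched linearly in
time from `[s, T]` to `[τ, T]`. -/
theorem exists_joined_curve {m α T φm φp : ℝ} (hm : 0 < m) (hα : 0 < α) (hα2 : α < 2) {τ s : ℝ}
    (hτ : 0 ≤ τ) (hτT : τ < T) (hs : 0 < s) (hsT : s < T) {r θ r' θ' Q : ℝ → ℝ}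
    (hr : ContinuousOn r (Icc (-τ) τ)) (hθ : ContinuousOn θ (Icc (-τ) τ))
    (hQ : ContinuousOn Q (Icc (-τ) τ)) (hpos : ∀ t ∈ Icc (-τ) τ, 0 < r t)
    (hrd : ∀ t ∈ Ioo (-τ) τ, HasDerivAt r (r' t) t)
    (hθd : ∀ t ∈ Ioo (-τ) τ, HasDerivAt θ (θ' t) t)
    (hQd : ∀ t ∈ Ioo (-τ) τ, HasDerivAt Q
      (((r' t) ^ 2 + (r t * θ' t) ^ 2) / 2 + m / α / r t ^ α) t)
    (hrl : r (-τ) = rbar m α s) (hrr : r τ = rbar m α s) (hθl : θ (-τ) = φm) (hθr : θ τ = φp)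
    {l : ℝ} (hl : l = (T - τ) / (T - s)) (hQpos : Q (-τ) ≤ Q τ) :
    ∃ x ∈ GammaStar m α T φm φp, action m α T x ≤
      ENNReal.ofReal (Q τ - Q (-τ) +
        (l + 1 / l) * (jacobi m α (rbar m α T) - jacobi m α (rbar m α s))) := by
  have hT : 0 < T := hs.trans hsT
  have hl0 : 0 < l := by rw [hl]; exact div_pos (by linarith) (by linarith)
  set c : ℝ → ℝ := fun t => max (-τ) (min t τ) with hc
  have hcc : Continuous c := by fun_prop
  have hcm : ∀ t, c t ∈ Icc (-τ) τ := fun t =>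
    ⟨le_max_left _ _, max_le (by linarith) (min_le_right _ _)⟩
  have hcr : ∀ t, τ ≤ t → c t = τ := fun t ht => by
    simp only [hc, min_eq_right ht]; exact max_eq_right (by linarith)
  have hcl : ∀ t, t ≤ -τ → c t = -τ := fun t ht => by
    simp only [hc]; exact max_eq_left ((min_le_left _ _).trans ht)
  have hci : ∀ t ∈ Icc (-τ) τ, c t = t := fun t ht => by
    simp only [hc, min_eq_left ht.2, max_eq_right ht.1]
  -- The clock `w` rests at `s` on `[-τ, τ]` and runs from `s` to `T` as `|t|` goes from `τ` to `T`.
  -- With the clamp `c`, the single formula for `R` gives `r` inside and `rbar (w t)` outside, so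
  -- continuity needs no gluing.
  set w : ℝ → ℝ := fun t => max |t| τ / l + (s - τ / l) with hw
  set R : ℝ → ℝ := fun t => r (c t) + rbar m α (w t) - rbar m α s with hR
  set Θ : ℝ → ℝ := fun t => θ (c t) with hΘ
  have hws : ∀ t, s ≤ w t := fun t => by
    have : τ / l ≤ max |t| τ / l := by gcongr; exact le_max_right _ _
    simp only [hw]; linarith
  have hwT : ∀ t, |t| = T → w t = T := fun t ht => by
    simp only [hw, ht, max_eq_left hτT.le]
    have h1 : T - s ≠ 0 := by linarith
    have h2 : T - τ ≠ 0 := by linarith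
    have : (T - τ) / l = T - s := by rw [hl]; field_simp
    rw [← add_sub_assoc, add_sub_right_comm, ← sub_div, this]; ring
  have hmono : ∀ t, rbar m α s ≤ rbar m α (w t) := fun t => by
    have := mu_pos hm hα
    unfold rbar
    gcongr
    exact hws t
  have hRpos : ∀ t, 0 < R t := fun t => by
    have h1 := hpos _ (hcm t)
    have h2 := hmono t
    simp only [hR]; linarith
  have hRc : Continuous R := by
    refine ((hr.comp_continuous hcc hcm).add ((continuous_rbar hα).comp ?_)).sub continuous_const
    fun_prop
  have hΘc : Continuous Θ := hθ.comp_continuous hcc hcm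
  have hxc : Continuous (polar R Θ) := by
    unfold polar
    fun_prop
  have hright : ∀ t, τ ≤ t → polar R Θ t =
      polar (fun t => rbar m α (1 * t / l + (s - τ / l))) (fun _ => φp) t := fun t ht => by
    simp only [polar, hR, hΘ, hcr t ht, hrr, hθr, hw, abs_of_nonneg (hτ.trans ht), max_eq_left ht,
      add_sub_cancel_left, one_mul]
  have hleft : ∀ t, t ≤ -τ → polar R Θ t =
      polar (fun t => rbar m α (-1 * t / l + (s - τ / l))) (fun _ => φm) t := fun t ht => by
    have h1 : |t| = -t := abs_of_nonpos (by linarith)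
    simp only [polar, hR, hΘ, hcl t ht, hrl, hθl, hw, h1, max_eq_left (le_neg.1 ht),
      add_sub_cancel_left, neg_one_mul]
  have hmid : ∀ t ∈ Icc (-τ) τ, polar R Θ t = polar r θ t := fun t ht => by
    have h1 : max |t| τ = τ := max_eq_right (abs_le.2 ht)
    have h2 : τ / l + (s - τ / l) = s := by ring
    simp only [polar, hR, hΘ, hci t ht, hw, h1, h2, add_sub_cancel_right]
  have hstr : ∀ ε t : ℝ, τ ≤ ε * t → 0 < ε * t / l + (s - τ / l) := fun ε t h => by
    have : τ / l ≤ ε * t / l := by gcongr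
    linarith
  have hQc : ∀ ε : ℝ, Continuous fun t => ε * ((l + 1 / l) / 2) *
      jacobi m α (rbar m α (ε * t / l + (s - τ / l))) := fun ε =>
    continuous_const.mul ((continuous_jacobi m hα2).comp ((continuous_rbar hα).comp (by fun_prop)))
  obtain ⟨a1, d1⟩ := lintegral_lagrangian_polar hm hα (x := polar R Θ) (a := -T) (b := -τ)
    (by linarith) (fun t ht => hleft t ht.2.le) (fun t ht => rbar_pos hm hα (hstr (-1) t
      (by linarith [ht.2]))) (fun t ht => (hasDerivAt_stretched hm hα hα2 hl0 (by norm_num)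
      (hstr (-1) t (by linarith [ht.2]))).1) (fun t _ => hasDerivAt_const t φm)
    (hQc (-1)).continuousOn (fun t ht => (hasDerivAt_stretched hm hα hα2 hl0 (by norm_num)
      (hstr (-1) t (by linarith [ht.2]))).2)
  obtain ⟨a2, d2⟩ := lintegral_lagrangian_polar hm hα (x := polar R Θ) (a := -τ) (b := τ)
    (by linarith) (fun t ht => hmid t (Ioo_subset_Icc_self ht))
    (fun t ht => hpos t (Ioo_subset_Icc_self ht)) hrd hθd hQ hQd
  obtain ⟨a3, d3⟩ := lintegral_lagrangian_polar hm hα (x := polar R Θ) (a := τ) (b := T)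
    hτT.le (fun t ht => hright t ht.1.le) (fun t ht => rbar_pos hm hα (hstr 1 t
      (by linarith [ht.1]))) (fun t ht => (hasDerivAt_stretched hm hα hα2 hl0 (by norm_num)
      (hstr 1 t (by linarith [ht.1]))).1) (fun t _ => hasDerivAt_const t φp)
    (hQc 1).continuousOn (fun t ht => (hasDerivAt_stretched hm hα hα2 hl0 (by norm_num)
      (hstr 1 t (by linarith [ht.1]))).2)
  have hact : action m α T (polar R Θ) ≤ ENNReal.ofReal (Q τ - Q (-τ) +
        (l + 1 / l) * (jacobi m α (rbar m α T) - jacobi m α (rbar m α s))) := by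
    refine (action_le_add_add τ).trans (le_of_eq ?_)
    have e1 : T / l + (s - τ / l) = T := by
      have := hwT T (abs_of_pos hT)
      simpa only [hw, abs_of_pos hT, max_eq_left hτT.le] using this
    have e2 : τ / l + (s - τ / l) = s := by ring
    have hJ : jacobi m α (rbar m α s) ≤ jacobi m α (rbar m α T) := by
      have h1 := hmono T
      rw [hwT T (abs_of_pos hT)] at h1
      have h2 := (rbar_pos hm hα hs).le
      have h3 : 0 < 1 - α / 2 := by linarith
      unfold jacobi
      gcongr
    rw [a1, a2, a3]
    simp only [neg_one_mul, neg_neg, one_mul, e1, e2]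
    have h4 : 0 ≤ (l + 1 / l) / 2 * (jacobi m α (rbar m α T) - jacobi m α (rbar m α s)) :=
      mul_nonneg (by positivity) (by linarith)
    rw [← ENNReal.ofReal_add (by linarith) (by linarith),
      ← ENNReal.ofReal_add (by linarith) (by linarith)]
    congr 1
    ring
  have hmem : MemH1 T (polar R Θ) := by
    refine memH1_of_energy hT (s := {-τ, τ}) (by simp) hxc.continuousOn (fun t ht => ?_) ?_
    · have hne : t ≠ -τ ∧ t ≠ τ := by simpa using ht.2
      rcases lt_or_gt_of_ne hne.1 with h1 | h1
      · exact d1 t ⟨ht.1.1, h1⟩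
      rcases lt_or_gt_of_ne hne.2 with h2 | h2
      · exact d2 t ⟨h1, h2⟩
      · exact d3 t ⟨h2, ht.1.2⟩
    · refine ne_top_of_le_ne_top (ne_top_of_le_ne_top ENNReal.ofReal_ne_top hact) ?_
      exact lintegral_mono fun t => le_self_add
  refine ⟨⟨polar R Θ, hmem⟩, ⟨fun t _ => ?_, ?_, ?_, Θ, hΘc.continuousOn, ?_, ?_, ?_⟩, hact⟩
  · rw [← norm_pos_iff]
    simp only [norm_polar (hRpos t).le, hRpos t]
  · rw [xbar_of_neg (neg_neg_iff_pos.2 hT), neg_neg]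
    simp only [polar, hR, hΘ, hcl (-T) (by linarith), hwT (-T) (by rw [abs_neg, abs_of_pos hT]),
      hrl, hθl, add_sub_cancel_left]
  · rw [xbar_of_pos hT]
    simp only [polar, hR, hΘ, hcr T hτT.le, hwT T (abs_of_pos hT),
      hrr, hθr, add_sub_cancel_left]
  · simp only [hΘ, hcl (-T) (by linarith : -T ≤ -τ), hθl]
  · simp only [hΘ, hcr T hτT.le, hθr]
  · intro t _
    simp only [norm_polar (hRpos t).le]
    rfl

/-! ### Short circular arcs near the collision -/

theorem rbar_rpow {m α s : ℝ} (hm : 0 < m) (hα : 0 < α) (hs : 0 < s) (q : ℝ) :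
    rbar m α s ^ q = (mu m α * s) ^ (2 / (α + 2) * q) := by
  rw [rbar, ← Real.rpow_mul (mul_pos (mu_pos hm hα) hs).le]

/-- Short circular arcs at the collision: the infimum of the action over `GammaStar` is at most
the action of the collision-ejection solution. -/
theorem exists_mem_GammaStar_action_le {m α T φm φp : ℝ} (hm : 0 < m) (hα : 0 < α) (hα2 : α < 2)
    (hT : 0 < T) {ε : ℝ} (hε : 0 < ε) :
    ∃ x ∈ GammaStar m α T φm φp, action m α T x ≤
      ENNReal.ofReal (2 * jacobi m α (rbar m α T) + ε) := by
  have hμ := mu_pos hm hα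
  -- Turning uniformly on the circle of radius `rbar s` for time `2 * s` costs exactly `C * (mu * s)
  -- ^ p`, which tends to `0` with `s`.
  set C : ℝ := mu m α * (φp - φm) ^ 2 / 4 + 2 * m / (α * mu m α) with hC
  set p : ℝ := (2 - α) / (α + 2) with hp
  have hp0 : 0 < p := div_pos (by linarith) (by linarith)
  have hlim : Tendsto (fun s : ℝ => C * (mu m α * s) ^ p) (𝓝[>] 0) (𝓝 0) := by
    have hcont : Continuous fun s : ℝ => C * (mu m α * s) ^ p :=
      continuous_const.mul ((Real.continuous_rpow_const hp0.le).comp (by fun_prop))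
    have h := hcont.tendsto 0
    simp only [mul_zero, Real.zero_rpow hp0.ne'] at h
    exact h.mono_left nhdsWithin_le_nhds
  obtain ⟨s, hsε, hs0, hsT⟩ := ((hlim.eventually (gt_mem_nhds hε)).and
    (Ioo_mem_nhdsGT hT)).exists
  have hr := rbar_pos hm hα hs0
  set r := rbar m α s with hrdef
  set q : ℝ := (0 ^ 2 + (r * ((φp - φm) / (2 * s))) ^ 2) / 2 + m / α / r ^ α with hq
  have hq0 : 0 < q := by positivity
  have hμs : 0 < mu m α * s := mul_pos hμ hs0
  have e1 : r ^ 2 = (mu m α * s) ^ p * (mu m α * s) := by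
    rw [← Real.rpow_natCast, rbar_rpow hm hα hs0, ← Real.rpow_add_one hμs.ne']
    congr 1
    rw [hp]; push_cast; field_simp; ring
  have e2 : r ^ α * (mu m α * s) ^ p = mu m α * s := by
    rw [rbar_rpow hm hα hs0, ← Real.rpow_add hμs]
    have : 2 / (α + 2) * α + p = 1 := by rw [hp]; field_simp; ring
    rw [this, Real.rpow_one]
  have e3 : 2 * s * q = C * (mu m α * s) ^ p := by
    have hrα : 0 < r ^ α := by positivity
    have e4 : s / r ^ α = (mu m α * s) ^ p / mu m α := by
      rw [div_eq_div_iff hrα.ne' hμ.ne']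
      linarith
    calc 2 * s * q = r ^ 2 * (φp - φm) ^ 2 / (4 * s) + 2 * (m / α) * (s / r ^ α) := by
          rw [hq]; field_simp; ring
      _ = _ := by rw [e1, e4, hC]; field_simp
  -- Here `τ = s`, so `l = 1` and the radial arcs are not stretched.
  obtain ⟨x, hx, hxa⟩ := exists_joined_curve (φm := φm) (φp := φp) hm hα hα2 hs0.le hsT hs0 hsT
    (r := fun _ => r) (θ := fun t => (φm + φp) / 2 + (φp - φm) / (2 * s) * t) (r' := fun _ => 0)
    (θ' := fun _ => (φp - φm) / (2 * s)) (Q := fun t => q * t) continuousOn_const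
    (by fun_prop) (by fun_prop) (fun _ _ => hr) (fun t _ => hasDerivAt_const t r)
    (fun t _ => (hasDerivAt_const_mul _).const_add _) (fun t _ => hasDerivAt_const_mul _) rfl rfl
    (by field_simp; ring) (by field_simp; ring) rfl (by nlinarith)
  refine ⟨x, hx, hxa.trans (ENNReal.ofReal_le_ofReal ?_)⟩
  rw [div_self (by linarith : T - s ≠ 0)]
  have h5 : 0 ≤ jacobi m α (rbar m α s) := jacobi_nonneg hα2 hr.le
  have h6 : q * s - q * -s = C * (mu m α * s) ^ p := by rw [← e3]; ring
  rw [h6]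
  have h7 : C * (mu m α * s) ^ p < ε := hsε
  nlinarith

/-! ### Cutting the corner along a chord -/

/-- Reparametrization of the line by an even positive density. -/
theorem exists_reparametrization {G : ℝ → ℝ} (hG : Continuous G) {g : ℝ} (hg : 0 < g)
    (hgG : ∀ x, g ≤ G x) (heven : ∀ x, G (-x) = G x) :
    ∃ u : ℝ → ℝ, (∀ t, HasDerivAt u (G (u t))⁻¹ t) ∧
      ∀ b, u (∫ v in (0 : ℝ)..b, G v) = b ∧ u (-∫ v in (0 : ℝ)..b, G v) = -b := by
  -- The map `u` is the inverse of this primitive: the lower bound `g` makes it onto, and evenness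
  -- of `G` makes it odd.
  set P : ℝ → ℝ := fun x => ∫ v in (0 : ℝ)..x, G v with hP
  have hPd : ∀ x, HasDerivAt P (G x) x := fun x =>
    intervalIntegral.integral_hasDerivAt_right (hG.intervalIntegrable _ _)
      (hG.stronglyMeasurableAtFilter _ _) hG.continuousAt
  have hPc : Continuous P := continuous_iff_continuousAt.2 fun x => (hPd x).continuousAt
  have hPm : StrictMono P := strictMono_of_deriv_pos fun x => by
    rw [(hPd x).deriv]; exact hg.trans_le (hgG x)
  have hPodd : ∀ x, P (-x) = -P x := fun x => by
    have h := intervalIntegral.integral_comp_neg (f := G) (a := 0) (b := x)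
    simp only [heven, neg_zero] at h
    simp only [hP, h]
    rw [intervalIntegral.integral_symm]
  have hPge : ∀ x, 0 ≤ x → g * x ≤ P x := fun x hx => by
    have h := intervalIntegral.integral_mono_on (μ := volume) hx (f := fun _ => g) (g := G)
      (by simp) (hG.intervalIntegrable _ _) (fun v _ => hgG v)
    simpa [mul_comm] using h
  have htop : Tendsto P atTop atTop := by
    refine tendsto_atTop_mono' _ ?_ (tendsto_id.const_mul_atTop hg)
    filter_upwards [eventually_ge_atTop 0] with x hx using hPge x hx
  have hbot : Tendsto P atBot atBot := by
    have h := tendsto_neg_atTop_atBot.comp (htop.comp tendsto_neg_atBot_atTop)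
    refine h.congr fun x => ?_
    simp [hPodd]
  have hsurj : Function.Surjective P := hPc.surjective htop hbot
  set e := hPm.orderIsoOfSurjective P hsurj
  have heu : ∀ t, P (e.symm t) = t := fun t => e.apply_symm_apply t
  have hue : ∀ x, e.symm (P x) = x := fun x => e.symm_apply_apply x
  refine ⟨e.symm, fun t => ?_, fun b => ⟨hue b, ?_⟩⟩
  · exact HasDerivAt.of_local_left_inverse e.symm.continuous.continuousAt (hPd _)
      (hg.trans_le (hgG _)).ne' (Eventually.of_forall heu)
  · have : -∫ v in (0 : ℝ)..b, G v = P (-b) := (hPodd b).symm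
    rw [this]; exact hue _

/-- The zero-energy motion along the straight line `a + i u` in the plane of the variable
`x ^ (1 - α / 2)`, in polar coordinates of the `x`-plane. -/
theorem hasDerivAt_line {m α : ℝ} (hm : 0 < m) (hα : 0 < α) (hα2 : α < 2) {β κ : ℝ}
    (hβ : β = 1 - α / 2) (hκ : κ = 1 / β - 1) {a σ φ : ℝ} (ha : 0 < a) (hσ : σ ^ 2 = 1)
    {u : ℝ → ℝ} {t : ℝ}
    (hu : HasDerivAt u ((a ^ 2 + u t ^ 2) ^ κ / (√(2 * m / α) * β))⁻¹ t) :
    ∃ r' θ' : ℝ, HasDerivAt (fun t => (a ^ 2 + u t ^ 2) ^ (1 / (2 * β))) r' t ∧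
      HasDerivAt (fun t => φ + σ / β * Real.arctan (u t / a)) θ' t ∧
      HasDerivAt (fun t => √(2 * m / α) / β * u t)
        ((r' ^ 2 + ((a ^ 2 + u t ^ 2) ^ (1 / (2 * β)) * θ') ^ 2) / 2 +
          m / α / ((a ^ 2 + u t ^ 2) ^ (1 / (2 * β))) ^ α) t := by
  -- For `x = (a + i u) ^ (1 / β)` the modulus is `(a ^ 2 + u ^ 2) ^ (1 / (2 * β))` and the argument
  -- is `arctan (u / a) / β`. Zero energy forces `u' = √(2m / α) * β * (a ^ 2 + u ^ 2) ^ (-κ)`, and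
  -- the Jacobi length is `√(2m / α) / β * u`.
  have hβ0 : 0 < β := by rw [hβ]; linarith
  have hk : 0 < √(2 * m / α) := Real.sqrt_pos.2 (by positivity)
  have hk2 : (√(2 * m / α)) ^ 2 = 2 * m / α := Real.sq_sqrt (by positivity)
  set k := √(2 * m / α) with hkdef
  have hD : 0 < a ^ 2 + u t ^ 2 := by positivity
  have h1 : HasDerivAt (fun t => a ^ 2 + u t ^ 2)
      (2 * u t * ((a ^ 2 + u t ^ 2) ^ κ / (k * β))⁻¹) t := by
    simpa using (hu.fun_pow 2).const_add (a ^ 2)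
  have h2 := h1.rpow_const (p := 1 / (2 * β)) (Or.inl hD.ne')
  have h3 := ((hu.div_const a).arctan.const_mul (σ / β)).const_add φ
  refine ⟨_, _, h2, h3, (hu.const_mul (k / β)).congr_deriv ?_⟩
  set D := a ^ 2 + u t ^ 2 with hDdef
  set V := (D ^ κ / (k * β))⁻¹ with hV
  have hX : 0 < D ^ κ := Real.rpow_pos_of_pos hD _
  have e1 : (D ^ (1 / (2 * β))) ^ α = D ^ κ := by
    rw [← Real.rpow_mul hD.le]
    congr 1
    rw [hκ, show α = 2 - 2 * β by rw [hβ]; ring]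
    field_simp
  have e2 : (D ^ (1 / (2 * β))) ^ 2 = D ^ κ * D := by
    rw [← Real.rpow_natCast, ← Real.rpow_mul hD.le, ← Real.rpow_add_one hD.ne']
    congr 1
    rw [hκ]; push_cast; field_simp; ring
  have e3 : D ^ (1 / (2 * β) - 1) = D ^ (1 / (2 * β)) / D := Real.rpow_sub_one hD.ne' _
  have e4 : 1 + (u t / a) ^ 2 = D / a ^ 2 := by rw [hDdef]; field_simp
  have e5 : V = k * β / D ^ κ := by rw [hV, inv_div]
  have e6 : m / α = k ^ 2 / 2 := by rw [hk2]; ring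
  rw [e1, e3, e4, e6]
  generalize hY : D ^ (1 / (2 * β)) = Y at *
  generalize hX' : D ^ κ = X at *
  -- The squared speed is `2U`: radial and angular parts combine through `u ^ 2 + a ^ 2 = D`.
  have e7 : (2 * u t * V * (1 / (2 * β)) * (Y / D)) ^ 2 +
      (Y * (σ / β * (1 / (D / a ^ 2) * (V / a)))) ^ 2 = k ^ 2 / X := by
    calc _ = Y ^ 2 * V ^ 2 / (β ^ 2 * D ^ 2) * (u t ^ 2 + σ ^ 2 * a ^ 2) := by
          field_simp
      _ = Y ^ 2 * V ^ 2 / (β ^ 2 * D ^ 2) * D := by rw [hσ, hDdef]; ring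
      _ = _ := by rw [e2, e5]; field_simp
  rw [e7, e5]
  field_simp
  ring

theorem jacobi_rbar_le {m α s T : ℝ} (hm : 0 < m) (hα : 0 < α) (hα2 : α < 2) (hs : 0 < s)
    (hsT : s ≤ T) : jacobi m α (rbar m α s) ≤ jacobi m α (rbar m α T) := by
  have hμ := mu_pos hm hα
  have h1 : 0 < 1 - α / 2 := by linarith
  have h2 := (rbar_pos hm hα hs).le
  have h6 : rbar m α s ≤ rbar m α T := by
    unfold rbar
    gcongr
  unfold jacobi
  gcongr

/-- Used to bound the duration of the chord by a multiple of `s`. -/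
theorem rbar_rpow_identity {m α s : ℝ} (hm : 0 < m) (hα : 0 < α) (hα2 : α < 2) (hs : 0 < s)
    {β : ℝ} (hβ : β = 1 - α / 2) :
    rbar m α s ^ β * ((rbar m α s ^ β) ^ 2) ^ (1 / β - 1) = mu m α * s := by
  have hβ0 : 0 < β := by rw [hβ]; linarith
  have hr := rbar_pos hm hα hs
  have e : β + β * (2 : ℕ) * (1 / β - 1) = (α + 2) / 2 := by
    push_cast
    field_simp
    rw [hβ]; ring
  rw [← Real.rpow_natCast, ← Real.rpow_mul hr.le, ← Real.rpow_mul hr.le, ← Real.rpow_add hr, e,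
    rbar_rpow hm hα hs, show 2 / (α + 2) * ((α + 2) / 2) = 1 by field_simp, Real.rpow_one]

/-- The straight arc in the plane of `x ^ (1 - α / 2)`, joined to the stretched radial
solutions. -/
theorem exists_line_curve {m α T φm φp : ℝ} (hm : 0 < m) (hα : 0 < α) (hα2 : α < 2)
    {β ω s : ℝ} (hβ : β = 1 - α / 2) (hω : ω = β * |φp - φm| / 2) (hω1 : ω < Real.pi / 2)
    (hs : 0 < s) (hsT : s < T) (hLs : mu m α / (√(2 * m / α) * β) * s < T) :
    ∃ τ, 0 ≤ τ ∧ τ ≤ mu m α / (√(2 * m / α) * β) * s ∧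
      ∃ x ∈ GammaStar m α T φm φp, action m α T x ≤
        ENNReal.ofReal (2 * jacobi m α (rbar m α s) * Real.sin ω +
          ((T - τ) / (T - s) + 1 / ((T - τ) / (T - s))) *
            (jacobi m α (rbar m α T) - jacobi m α (rbar m α s))) := by
  have hβ0 : 0 < β := by rw [hβ]; linarith
  have hκ0 : 0 ≤ 1 / β - 1 := by
    rw [sub_nonneg, le_div_iff₀ hβ0]; linarith
  have hk : 0 < √(2 * m / α) := Real.sqrt_pos.2 (by positivity)
  have hω0 : 0 ≤ ω := by rw [hω]; positivity
  have hcos : 0 < Real.cos ω := Real.cos_pos_of_mem_Ioo ⟨by linarith, hω1⟩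
  have hsin0 : 0 ≤ Real.sin ω := Real.sin_nonneg_of_nonneg_of_le_pi hω0 (by linarith)
  obtain ⟨σ, hσ, hσφ⟩ : ∃ σ : ℝ, σ ^ 2 = 1 ∧ σ * |φp - φm| = φp - φm := by
    rcases le_total 0 (φp - φm) with h | h
    · exact ⟨1, by norm_num, by rw [abs_of_nonneg h, one_mul]⟩
    · exact ⟨-1, by norm_num, by rw [abs_of_nonpos h]; ring⟩
  have hr := rbar_pos hm hα hs
  have hρpow := rbar_rpow_identity hm hα hα2 hs hβ
  have hend : ((rbar m α s ^ β) ^ 2) ^ (1 / (2 * β)) = rbar m α s := by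
    rw [← Real.rpow_natCast, ← Real.rpow_mul hr.le, ← Real.rpow_mul hr.le,
      show β * (2 : ℕ) * (1 / (2 * β)) = 1 by push_cast; field_simp, Real.rpow_one]
  have hJs : jacobi m α (rbar m α s) = √(2 * m / α) / β * rbar m α s ^ β := by rw [jacobi, hβ]
  have hρ0 : 0 < rbar m α s ^ β := Real.rpow_pos_of_pos hr _
  rw [hJs]
  generalize rbar m α s ^ β = ρ at *
  -- The segments of length `ρ` and their chord form an isosceles triangle with apex angle `2 * ω`;
  -- `a` is its height and `b` half of the chord.
  obtain ⟨a, ha⟩ : ∃ a, a = ρ * Real.cos ω := ⟨_, rfl⟩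
  obtain ⟨b, hb⟩ : ∃ b, b = ρ * Real.sin ω := ⟨_, rfl⟩
  have ha0 : 0 < a := ha ▸ mul_pos hρ0 hcos
  have hb0 : 0 ≤ b := hb ▸ mul_nonneg hρ0.le hsin0
  have hbρ : b ≤ ρ := by rw [hb]; exact mul_le_of_le_one_right hρ0.le (Real.sin_le_one _)
  have hab : a ^ 2 + b ^ 2 = ρ ^ 2 := by
    rw [ha, hb]; linear_combination ρ ^ 2 * Real.sin_sq_add_cos_sq ω
  have hatan : Real.arctan (b / a) = ω := by
    rw [ha, hb, mul_div_mul_left _ _ hρ0.ne', ← Real.tan_eq_sin_div_cos]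
    exact Real.arctan_tan (by linarith) hω1
  have hσω : σ / β * ω = (φp - φm) / 2 := by
    rw [hω, ← mul_div_assoc, ← mul_assoc, div_mul_cancel₀ _ hβ0.ne', hσφ]
  have hGc : Continuous fun v : ℝ => (a ^ 2 + v ^ 2) ^ (1 / β - 1) / (√(2 * m / α) * β) :=
    ((Real.continuous_rpow_const hκ0).comp (by fun_prop)).div_const _
  obtain ⟨u, hud, hub⟩ := exists_reparametrization hGc
    (g := (a ^ 2) ^ (1 / β - 1) / (√(2 * m / α) * β)) (by positivity)
    (fun v => by gcongr; exact le_add_of_nonneg_right (sq_nonneg v)) (fun v => by rw [neg_sq])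
  have hτ0 : 0 ≤ ∫ v in (0 : ℝ)..b, (a ^ 2 + v ^ 2) ^ (1 / β - 1) / (√(2 * m / α) * β) :=
    intervalIntegral.integral_nonneg hb0 fun v _ => by positivity
  -- The density is largest at the ends of the chord, where `a ^ 2 + v ^ 2 = ρ ^ 2`, and `b ≤ ρ`.
  have hτL : ∫ v in (0 : ℝ)..b, (a ^ 2 + v ^ 2) ^ (1 / β - 1) / (√(2 * m / α) * β) ≤
      mu m α / (√(2 * m / α) * β) * s := by
    have h := intervalIntegral.integral_mono_on (μ := volume) hb0
      (g := fun _ => (ρ ^ 2) ^ (1 / β - 1) / (√(2 * m / α) * β)) (hGc.intervalIntegrable _ _)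
      (by simp) (fun v hv => by
        rw [← hab]
        have := hv.1
        have := hv.2
        gcongr)
    rw [intervalIntegral.integral_const, sub_zero, smul_eq_mul] at h
    calc _ ≤ _ := h
      _ ≤ ρ * ((ρ ^ 2) ^ (1 / β - 1) / (√(2 * m / α) * β)) := by gcongr
      _ = mu m α / (√(2 * m / α) * β) * s := by rw [← mul_div_assoc, hρpow]; ring
  obtain ⟨hu1, hu2⟩ := hub b
  generalize (∫ v in (0 : ℝ)..b, (a ^ 2 + v ^ 2) ^ (1 / β - 1) / (√(2 * m / α) * β)) = τ at *
  have hline := fun t => hasDerivAt_line hm hα hα2 hβ rfl (φ := (φm + φp) / 2) ha0 hσ (hud t)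
  choose r' θ' hrd hθd hQd using hline
  refine ⟨τ, hτ0, hτL, ?_⟩
  obtain ⟨x, hx, hxa⟩ := exists_joined_curve (φm := φm) (φp := φp) hm hα hα2 hτ0
    (hτL.trans_lt hLs) hs hsT
    (r := fun t => (a ^ 2 + u t ^ 2) ^ (1 / (2 * β)))
    (θ := fun t => (φm + φp) / 2 + σ / β * Real.arctan (u t / a)) (r' := r') (θ' := θ')
    (Q := fun t => √(2 * m / α) / β * u t)
    (fun t _ => (hrd t).continuousAt.continuousWithinAt)
    (fun t _ => (hθd t).continuousAt.continuousWithinAt)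
    (fun t _ => (hQd t).continuousAt.continuousWithinAt) (fun t _ => by positivity)
    (fun t _ => hrd t) (fun t _ => hθd t) (fun t _ => hQd t)
    (by simp only [hu2, neg_sq, hab, hend]) (by simp only [hu1, hab, hend])
    (by simp only [hu2, neg_div, Real.arctan_neg, hatan, mul_neg, hσω]; ring)
    (by simp only [hu1, hatan, hσω]; ring) rfl
    (by simp only [hu1, hu2]; gcongr; linarith)
  refine ⟨x, hx, hxa.trans (le_of_eq ?_)⟩
  simp only [hu1, hu2, hJs, hb]
  congr 2
  ring

/-- Since `l + 1 / l` has its minimum `2` at `l = 1`, the excess is quadratic in the time mismatch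
`s - τ`, which is `O(s)`. -/
theorem stretch_excess {T s τ L : ℝ} (hs : 0 < s) (hτ : 0 ≤ τ) (hsT : s ≤ T / 2) (hτL : τ ≤ L * s)
    (hLs : L * s ≤ T / 2) (hT : 0 < T) :
    0 ≤ (T - τ) / (T - s) + 1 / ((T - τ) / (T - s)) - 2 ∧
    (T - τ) / (T - s) + 1 / ((T - τ) / (T - s)) - 2 ≤ 4 * (1 + L) ^ 2 / T ^ 2 * s ^ 2 := by
  have hTs : T / 2 ≤ T - s := by linarith
  have hTτ : T / 2 ≤ T - τ := by linarith
  have hTs0 : 0 < T - s := by linarith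
  have hTτ0 : 0 < T - τ := by linarith
  have e1 : (T - τ) / (T - s) + 1 / ((T - τ) / (T - s)) - 2 =
      (s - τ) ^ 2 / ((T - s) * (T - τ)) := by
    field_simp; ring
  have e2 : 4 * (1 + L) ^ 2 / T ^ 2 * s ^ 2 = ((1 + L) * s) ^ 2 / (T / 2 * (T / 2)) := by
    field_simp; ring
  have e3 : (s - τ) ^ 2 ≤ ((1 + L) * s) ^ 2 := by
    refine sq_le_sq' ?_ ?_ <;> linarith
  rw [e1, e2]
  exact ⟨by positivity, by gcongr⟩

/-- If the angle, measured in the plane of `x ^ (1 - α / 2)`, is less than `π`, then some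
collision-free curve has less action than the collision-ejection solution. -/
theorem exists_mem_GammaStar_action_lt {m α T φm φp : ℝ} (hm : 0 < m) (hα : 0 < α) (hα2 : α < 2)
    (hT : 0 < T) (hφ : (1 - α / 2) * |φp - φm| < Real.pi) :
    ∃ x ∈ GammaStar m α T φm φp, action m α T x <
      ENNReal.ofReal (2 * jacobi m α (rbar m α T)) := by
  have hμ := mu_pos hm hα
  obtain ⟨β, hβ⟩ : ∃ β : ℝ, β = 1 - α / 2 := ⟨_, rfl⟩
  have hβ0 : 0 < β := by rw [hβ]; linarith
  have hk : 0 < √(2 * m / α) := Real.sqrt_pos.2 (by positivity)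
  obtain ⟨ω, hω⟩ : ∃ ω : ℝ, ω = β * |φp - φm| / 2 := ⟨_, rfl⟩
  have hω1 : ω < Real.pi / 2 := by rw [hω, hβ]; linarith
  have hω0 : 0 ≤ ω := by rw [hω]; positivity
  have hsin0 : 0 ≤ Real.sin ω := Real.sin_nonneg_of_nonneg_of_le_pi hω0 (by linarith)
  have hsin1 : 0 < 1 - Real.sin ω := by
    have hcos : 0 < Real.cos ω := Real.cos_pos_of_mem_Ioo ⟨by linarith, hω1⟩
    nlinarith [Real.sin_sq_add_cos_sq ω]
  obtain ⟨L, hL⟩ : ∃ L, L = mu m α / (√(2 * m / α) * β) := ⟨_, rfl⟩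
  have hJT0 : 0 ≤ jacobi m α (rbar m α T) := jacobi_nonneg hα2 (rbar_pos hm hα hT).le
  have hkβ : 0 < √(2 * m / α) / β := div_pos hk hβ0
  -- The last condition, multiplied by `s`, says that the stretching cost is below the saving `2 *
  -- (1 - sin ω) * jacobi (rbar s)`. The condition `mu * s ≤ 1` bounds that saving below linearly,
  -- as `jacobi (rbar s)` is a power of `mu * s` with exponent at most `1`.
  obtain ⟨s, hs0, hsT, hLsT, hμs1, hsmall⟩ : ∃ s : ℝ, 0 < s ∧ s ≤ T / 2 ∧ L * s ≤ T / 2 ∧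
      mu m α * s ≤ 1 ∧ 4 * (1 + L) ^ 2 / T ^ 2 * jacobi m α (rbar m α T) * s <
        2 * (1 - Real.sin ω) * (√(2 * m / α) / β * mu m α) := by
    have ht : ∀ (c : ℝ) {d : ℝ}, 0 < d → ∀ᶠ s : ℝ in 𝓝[>] 0, c * s < d := fun c d hd => by
      have hc : Continuous fun s : ℝ => c * s := by fun_prop
      have h := hc.tendsto 0
      rw [mul_zero] at h
      exact (h.mono_left nhdsWithin_le_nhds).eventually (gt_mem_nhds hd)
    obtain ⟨s, h1, h2, h3, h4, h5⟩ := ((ht 1 (half_pos hT)).and ((ht L (half_pos hT)).and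
      ((ht (mu m α) one_pos).and ((ht _ (mul_pos (mul_pos two_pos hsin1)
        (mul_pos hkβ hμ))).and self_mem_nhdsWithin)))).exists
    exact ⟨s, h5, by linarith, h2.le, h3.le, h4⟩
  obtain ⟨τ, hτ0, hτL, x, hx, hxa⟩ := exists_line_curve (T := T) hm hα hα2 hβ hω hω1 hs0
    (by linarith) (hL ▸ by linarith)
  rw [← hL] at hτL
  obtain ⟨hl1, hl2⟩ := stretch_excess hs0 hτ0 hsT hτL hLsT hT
  refine ⟨x, hx, hxa.trans_lt ?_⟩
  have hJs : √(2 * m / α) / β * (mu m α * s) ≤ jacobi m α (rbar m α s) := by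
    rw [jacobi, ← hβ, rbar_rpow hm hα hs0]
    refine mul_le_mul_of_nonneg_left ?_ hkβ.le
    refine Real.self_le_rpow_of_le_one (mul_pos hμ hs0).le hμs1 ?_
    rw [div_mul_eq_mul_div, div_le_one (by positivity)]
    linarith
  have hJ0 : 0 ≤ jacobi m α (rbar m α s) := jacobi_nonneg hα2 (rbar_pos hm hα hs0).le
  have hJJ := jacobi_rbar_le hm hα hα2 hs0 (by linarith : s ≤ T)
  generalize (T - τ) / (T - s) + 1 / ((T - τ) / (T - s)) = E at *
  generalize jacobi m α (rbar m α s) = Js at *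
  generalize jacobi m α (rbar m α T) = JT at *
  have h7 : 0 ≤ E * (JT - Js) := mul_nonneg (by linarith) (by linarith)
  have h6 : 0 ≤ 2 * Js * Real.sin ω := by positivity
  refine (ENNReal.ofReal_lt_ofReal_iff_of_nonneg (by linarith)).2 ?_
  have h1 : (E - 2) * JT ≤ 4 * (1 + L) ^ 2 / T ^ 2 * s ^ 2 * JT := by gcongr
  have h2 : 4 * (1 + L) ^ 2 / T ^ 2 * s ^ 2 * JT <
      2 * (1 - Real.sin ω) * (√(2 * m / α) / β * (mu m α * s)) := by
    have := mul_lt_mul_of_pos_right hsmall hs0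
    linarith
  have h3 : 2 * (1 - Real.sin ω) * (√(2 * m / α) / β * (mu m α * s)) ≤
      2 * (1 - Real.sin ω) * Js := by gcongr
  have h4 : 0 ≤ (E - 2) * Js := mul_nonneg hl1 hJ0
  linarith

/-! ### The Euler-Lagrange equation -/

/-- The force field of the Kepler-type problem. -/
def force (m α : ℝ) (z : ℂ) : ℂ := -(m / ‖z‖ ^ (α + 2)) • z

theorem continuousAt_force (m α : ℝ) {z : ℂ} (hz : z ≠ 0) : ContinuousAt (force m α) z := by
  unfold force
  have hn : ‖z‖ ≠ 0 := norm_ne_zero_iff.2 hz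
  have h1 : ContinuousAt (fun z : ℂ => ‖z‖ ^ (α + 2)) z :=
    continuous_norm.continuousAt.rpow_const (Or.inl hn)
  have h2 : ‖z‖ ^ (α + 2) ≠ 0 := (Real.rpow_pos_of_pos (norm_pos_iff.2 hz) _).ne'
  exact ((continuousAt_const.div h1 h2).neg).smul continuousAt_id

theorem norm_force_le {m α δ B : ℝ} (hm : 0 < m) (hα : 0 < α) (hδ : 0 < δ) {z : ℂ} (h1 : δ ≤ ‖z‖)
    (h2 : ‖z‖ ≤ B) : ‖force m α z‖ ≤ m / δ ^ (α + 2) * B := by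
  rw [force, norm_smul, norm_neg, Real.norm_of_nonneg (by positivity)]
  gcongr

/-- The force is the gradient of `m / (α |z| ^ α)` with a plus sign, this being the negative of the
potential energy. -/
theorem hasDerivAt_potential {m α : ℝ} (hα : 0 < α) {z h : ℂ} {e : ℝ} (hz : z + (e : ℂ) * h ≠ 0) :
    HasDerivAt (fun e : ℝ => m / α / ‖z + (e : ℂ) * h‖ ^ α)
      (inner ℝ (force m α (z + (e : ℂ) * h)) h) e := by
  have hpos : 0 < ‖z + (e : ℂ) * h‖ := norm_pos_iff.2 hz
  have h1 : HasDerivAt (fun e : ℝ => z + (e : ℂ) * h) h e := by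
    simpa using ((Complex.ofRealCLM.hasDerivAt (x := e)).mul_const h).const_add z
  have h2 := (h1.norm_sq.rpow_const (p := -(α / 2)) (Or.inl (by positivity))).const_mul (m / α)
  have hpow : ∀ w : ℂ, ∀ q : ℝ, (‖w‖ ^ 2) ^ q = ‖w‖ ^ (2 * q) := fun w q => by
    rw [← Real.rpow_natCast, ← Real.rpow_mul (norm_nonneg w)]; norm_num
  have e1 : (fun e : ℝ => m / α / ‖z + (e : ℂ) * h‖ ^ α) =
      fun e : ℝ => m / α * (‖z + (e : ℂ) * h‖ ^ 2) ^ (-(α / 2)) := by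
    funext e
    rw [hpow, show 2 * -(α / 2) = -α by ring, Real.rpow_neg (norm_nonneg _), div_eq_mul_inv]
  rw [e1]
  refine h2.congr_deriv ?_
  rw [hpow, show 2 * (-(α / 2) - 1) = -(α + 2) by ring, Real.rpow_neg hpos.le, force,
    real_inner_smul_left]
  field_simp

theorem continuousAt_realPotential (m α : ℝ) {z : ℂ} (hz : z ≠ 0) :
    ContinuousAt (fun z : ℂ => m / α / ‖z‖ ^ α) z := by
  have h1 : ContinuousAt (fun z : ℂ => ‖z‖ ^ α) z :=
    continuous_norm.continuousAt.rpow_const (Or.inl (norm_ne_zero_iff.2 hz))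
  exact continuousAt_const.div h1 (Real.rpow_pos_of_pos (norm_pos_iff.2 hz) _).ne'

/-- Integration by parts against a variation vanishing at the end points. -/
theorem integral_inner_deriv_add {T : ℝ} (hT : 0 < T) {f f' : ℝ → ℂ}
    (hf : ∀ t, HasDerivAt f (f' t) t) (hf' : Continuous f') {z : H1Curve T}
    (hl : (z : ℝ → ℂ) (-T) = 0) (hr : (z : ℝ → ℂ) T = 0) :
    ∫ t in Icc (-T) T, (inner ℝ (f t) (deriv (z : ℝ → ℂ) t) + inner ℝ (f' t) ((z : ℝ → ℂ) t)) =
      0 := by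
  have hle : -T ≤ T := by linarith
  have hfd : ContDiff ℝ 1 f := by
    rw [contDiff_one_iff_deriv]
    exact ⟨fun t => (hf t).differentiableAt, by rwa [show deriv f = f' from
      funext fun t => (hf t).deriv]⟩
  have hfa : AbsolutelyContinuousOnInterval f (-T) T :=
    hfd.contDiffOn.absolutelyContinuousOnInterval
  have hcomp : ∀ (L : ℂ →L[ℝ] ℝ) {g : ℝ → ℂ}, AbsolutelyContinuousOnInterval g (-T) T →
      AbsolutelyContinuousOnInterval (fun t => L (g t)) (-T) T := fun L g hg =>
    absCont_comp_lipschitz (s := univ) hg L.lipschitz.lipschitzOnWith (mapsTo_univ _ _)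
  have hac : AbsolutelyContinuousOnInterval
      (fun t => inner ℝ (f t) ((z : ℝ → ℂ) t)) (-T) T := by
    refine absCont_congr (((hcomp Complex.reCLM hfa).fun_mul (hcomp Complex.reCLM z.2.absCont)).add
      ((hcomp Complex.imCLM hfa).fun_mul (hcomp Complex.imCLM z.2.absCont))) fun t _ => ?_
    simp [Complex.inner, mul_comm]
  have h1 := hac.integral_deriv_eq_sub
  rw [hl, hr, inner_zero_right, inner_zero_right, sub_zero, intervalIntegral.integral_of_le hle,
    ← integral_Icc_eq_integral_Ioc] at h1
  rw [← h1]
  refine integral_congr_ae ?_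
  filter_upwards [ae_differentiableAt_of_absCont z.2.absCont] with t ht
  exact (((hf t).inner ℝ ht.hasDerivAt).deriv).symm

theorem vel_add {T : ℝ} (x y : H1Curve T) : vel (x + y) = vel x + vel y := by
  unfold vel
  rw [← MemLp.toLp_add]
  exact MemLp.toLp_congr _ _ (deriv_add_ae x.2 y.2)

theorem vel_smul {T : ℝ} (c : ℂ) (x : H1Curve T) : vel (c • x) = c • vel x := by
  unfold vel
  rw [← MemLp.toLp_const_smul]
  exact MemLp.toLp_congr _ _ (deriv_smul_ae c x.2)

theorem re_inner_vel {T : ℝ} (x y : H1Curve T) :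
    (inner ℂ (vel x) (vel y) : ℂ).re =
      ∫ t in Icc (-T) T, inner ℝ (deriv (x : ℝ → ℂ) t) (deriv (y : ℝ → ℂ) t) := by
  rw [L2.inner_def]
  have h := integral_re (L2.integrable_inner (𝕜 := ℂ) (vel x) (vel y))
  have h' : (∫ t in Icc (-T) T, inner ℂ (vel x t) (vel y t)).re =
      ∫ t in Icc (-T) T, (inner ℂ (vel x t) (vel y t) : ℂ).re := h.symm
  rw [h']
  refine integral_congr_ae ?_
  filter_upwards [coeFn_vel x, coeFn_vel y] with t h1 h2
  rw [h1, h2]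
  simp [Complex.inner]

theorem norm_vel_add_smul_sq {T : ℝ} (x y : H1Curve T) (e : ℝ) :
    ‖vel (x + (e : ℂ) • y)‖ ^ 2 =
      ‖vel x‖ ^ 2 + 2 * e * (inner ℂ (vel x) (vel y) : ℂ).re + e ^ 2 * ‖vel y‖ ^ 2 := by
  rw [vel_add, vel_smul, norm_add_sq (𝕜 := ℂ), inner_smul_right, norm_smul]
  simp [mul_pow]
  ring

/-- The variation that replaces a curve on `[a, b]` by a given curve with the same end points. -/
theorem exists_replacement {T : ℝ} (hT : 0 < T) (x : H1Curve T) {a b : ℝ} (ha : -T ≤ a)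
    (hab : a < b) (hb : b ≤ T) {q q₁ : ℝ → ℂ} (hq : ∀ t, HasDerivAt q (q₁ t) t)
    (hq₁ : Continuous q₁) (hqa : q a = (x : ℝ → ℂ) a) (hqb : q b = (x : ℝ → ℂ) b) :
    ∃ z : H1Curve T, (∀ t ∈ Icc a b, (z : ℝ → ℂ) t = q t - (x : ℝ → ℂ) t) ∧
      (∀ t ∈ Icc (-T) T, t ∉ Icc a b → (z : ℝ → ℂ) t = 0) ∧
      (z : ℝ → ℂ) (-T) = 0 ∧ (z : ℝ → ℂ) T = 0 ∧
      deriv (z : ℝ → ℂ) =ᵐ[timeMeasure T]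
        (Ioc a b).indicator (fun t => q₁ t - deriv (x : ℝ → ℂ) t) := by
  have hle : -T ≤ T := by linarith
  have hq₁L : MemLp q₁ 2 (timeMeasure T) := by
    obtain ⟨C, hC⟩ := isCompact_Icc.exists_bound_of_continuousOn (s := Icc (-T) T)
      hq₁.continuousOn
    exact MemLp.of_bound hq₁.aestronglyMeasurable C
      ((ae_restrict_iff' measurableSet_Icc).2 (ae_of_all _ hC))
  have hv : MemLp ((Ioc a b).indicator fun t => q₁ t - deriv (x : ℝ → ℂ) t) 2 (timeMeasure T) :=
    (hq₁L.sub x.2.memLp_deriv).indicator measurableSet_Ioc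
  obtain ⟨hz, hzd⟩ := memH1_of_eq_integral hT (c := 0) (x := fun t => 0 + ∫ u in (-T)..t,
    (Ioc a b).indicator (fun t => q₁ t - deriv (x : ℝ → ℂ) t) u) hv (fun t _ => rfl)
  have hval : ∀ t ∈ Icc (-T) T, a ≤ t → (∫ u in (-T)..t,
      (Ioc a b).indicator (fun t => q₁ t - deriv (x : ℝ → ℂ) t) u) =
      q (min t b) - (x : ℝ → ℂ) (min t b) := by
    intro t ht hat
    have hm1 : a ≤ min t b := le_min hat hab.le
    have hmI : min t b ∈ Icc (-T) T := ⟨ha.trans hm1, (min_le_left _ _).trans ht.2⟩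
    have haI : a ∈ Icc (-T) T := ⟨ha, by linarith⟩
    rw [intervalIntegral.integral_of_le ht.1, setIntegral_indicator measurableSet_Ioc,
      Ioc_inter_Ioc, max_eq_right ha, ← intervalIntegral.integral_of_le hm1,
      intervalIntegral.integral_sub (hq₁.intervalIntegrable _ _)
        (MemLp.intervalIntegrable x.2.memLp_deriv haI hmI), x.2.sub_eq_integral haI hmI,
      intervalIntegral.integral_eq_sub_of_hasDerivAt (fun t _ => hq t)
        (hq₁.intervalIntegrable _ _), hqa]
    ring
  have hval' : ∀ t ∈ Icc (-T) T, t ≤ a → (∫ u in (-T)..t,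
      (Ioc a b).indicator (fun t => q₁ t - deriv (x : ℝ → ℂ) t) u) = 0 := by
    intro t ht hta
    rw [intervalIntegral.integral_of_le ht.1, setIntegral_indicator measurableSet_Ioc,
      Ioc_inter_Ioc, max_eq_right ha, Ioc_eq_empty (not_lt.2 ((min_le_left _ _).trans hta)),
      setIntegral_empty]
  refine ⟨⟨_, hz⟩, fun t ht => ?_, fun t ht htn => ?_, ?_, ?_, hzd⟩
  · simp only [zero_add]
    rw [hval t ⟨ha.trans ht.1, ht.2.trans hb⟩ ht.1, min_eq_left ht.2]
  · simp only [zero_add]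
    rcases le_or_gt t a with h | h
    · exact hval' t ht h
    · have hbt : b ≤ t := by
        by_contra hlt
        exact htn ⟨h.le, (not_le.1 hlt).le⟩
      rw [hval t ht h.le, min_eq_right hbt, hqb, sub_self]
  · simp
  · simp only [zero_add]
    rw [hval T (right_mem_Icc.2 hle) (by linarith), min_eq_right hb, hqb, sub_self]

theorem continuousOn_realPotential {m α T : ℝ} (y : H1Curve T) {s : Set ℝ} (hs : s ⊆ Icc (-T) T)
    (h0 : ∀ t ∈ s, (y : ℝ → ℂ) t ≠ 0) :
    ContinuousOn (fun t => m / α / ‖(y : ℝ → ℂ) t‖ ^ α) s := fun t ht =>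
  ContinuousAt.comp_continuousWithinAt (f := (y : ℝ → ℂ)) (g := fun z : ℂ => m / α / ‖z‖ ^ α)
    (continuousAt_realPotential m α (h0 t ht)) ((continuousOn_curve y).mono hs t ht)

/-- Isolates the potential outside `[a, b]`, where collisions may occur; a variation supported in
`[a, b]` leaves this term unchanged, so it cancels. -/
theorem action_eq_split {m α T : ℝ} (hm : 0 < m) (hα : 0 < α) {y : H1Curve T} {a b : ℝ}
    (hab : Icc a b ⊆ Icc (-T) T) (h0 : ∀ t ∈ Icc a b, (y : ℝ → ℂ) t ≠ 0) :
    action m α T y = ENNReal.ofReal (‖vel y‖ ^ 2 / 2 +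
        ∫ t in Icc a b, m / α / ‖(y : ℝ → ℂ) t‖ ^ α) +
      ∫⁻ t in Icc (-T) T \ Icc a b, potential m α ((y : ℝ → ℂ) t) := by
  have hc := continuousOn_realPotential (m := m) (α := α) y hab h0
  have hJ : ∫⁻ t in Icc a b, potential m α ((y : ℝ → ℂ) t) =
      ENNReal.ofReal (∫ t in Icc a b, m / α / ‖(y : ℝ → ℂ) t‖ ^ α) := by
    rw [ofReal_integral_eq_lintegral_ofReal (hc.integrableOn_compact isCompact_Icc)
      (ae_of_all _ fun t => by positivity)]
    exact setLIntegral_congr_fun measurableSet_Icc fun t ht => potential_eq_ofReal (h0 t ht)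
  rw [action_eq, ← lintegral_inter_add_sdiff (μ := volume) _ (Icc (-T) T)
    (measurableSet_Icc (a := a) (b := b)), inter_eq_right.2 hab, hJ, ← add_assoc,
    ← ENNReal.ofReal_add (by positivity) (integral_nonneg fun t => by positivity)]

/-- The first variation of the action at a minimizer vanishes. -/
theorem first_variation {m α T φm φp : ℝ} (hm : 0 < m) (hα : 0 < α) (hT : 0 < T)
    {x z : H1Curve T} (hx : x ∈ Gamma m α T φm φp)
    (hmin : ∀ y ∈ Gamma m α T φm φp, action m α T x ≤ action m α T y)
    (hfin : action m α T x < ⊤) {a b : ℝ} (hab : Icc a b ⊆ Icc (-T) T)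
    (h0 : ∀ t ∈ Icc a b, (x : ℝ → ℂ) t ≠ 0)
    (hz : ∀ t ∈ Icc (-T) T, t ∉ Icc a b → (z : ℝ → ℂ) t = 0)
    (hzl : (z : ℝ → ℂ) (-T) = 0) (hzr : (z : ℝ → ℂ) T = 0) :
    (inner ℂ (vel x) (vel z) : ℂ).re +
      ∫ t in Icc a b, inner ℝ (force m α ((x : ℝ → ℂ) t)) ((z : ℝ → ℂ) t) = 0 := by
  obtain ⟨d, hd0, hd⟩ := exists_norm_lower_bound x isCompact_Icc hab h0
  obtain ⟨N, hN⟩ := isCompact_Icc.exists_bound_of_continuousOn (continuousOn_curve z)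
  obtain ⟨B, hB⟩ := isCompact_Icc.exists_bound_of_continuousOn (continuousOn_curve x)
  have hN0 : 0 ≤ N := (norm_nonneg _).trans (hN T (right_mem_Icc.2 (by linarith)))
  -- This makes `|e| * ‖z‖ ≤ d / 2` for `|e| < ε`, so the varied curves keep distance `d / 2` from
  -- the origin on `[a, b]`; `N + 1` avoids dividing by zero.
  obtain ⟨ε, hε⟩ : ∃ ε, ε = d / 2 / (N + 1) := ⟨_, rfl⟩
  have hε0 : 0 < ε := by rw [hε]; positivity
  have hez : ∀ e : ℝ, |e| < ε → ∀ t ∈ Icc (-T) T, ‖(e : ℂ) * (z : ℝ → ℂ) t‖ ≤ d / 2 := by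
    intro e he t ht
    rw [norm_mul, Complex.norm_real, Real.norm_eq_abs]
    calc |e| * ‖(z : ℝ → ℂ) t‖ ≤ ε * (N + 1) := by
          gcongr
          linarith [hN t ht]
      _ = d / 2 := by rw [hε]; field_simp
  have hlow : ∀ e : ℝ, |e| < ε → ∀ t ∈ Icc a b,
      d / 2 ≤ ‖(x : ℝ → ℂ) t + (e : ℂ) * (z : ℝ → ℂ) t‖ := by
    intro e he t ht
    have h1 := hez e he t (hab ht)
    have h2 := norm_sub_le_norm_add ((x : ℝ → ℂ) t) ((e : ℂ) * (z : ℝ → ℂ) t)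
    linarith [hd t ht]
  have hne : ∀ e : ℝ, |e| < ε → ∀ t ∈ Icc a b,
      (x : ℝ → ℂ) t + (e : ℂ) * (z : ℝ → ℂ) t ≠ 0 := fun e he t ht =>
    norm_pos_iff.1 ((half_pos hd0).trans_le (hlow e he t ht))
  have hcont : ∀ e : ℝ, |e| < ε → ContinuousOn
      (fun t => m / α / ‖(x : ℝ → ℂ) t + (e : ℂ) * (z : ℝ → ℂ) t‖ ^ α) (Icc a b) := fun e he =>
    continuousOn_realPotential (x + (e : ℂ) • z) hab (hne e he)
  have hmem : ∀ e : ℝ, |e| < ε → x + (e : ℂ) • z ∈ Gamma m α T φm φp := by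
    intro e he
    refine add_mem_Gamma hT hx (by simp [hzl]) (by simp [hzr]) (half_pos hd0) fun t ht => ?_
    by_cases htJ : t ∈ Icc a b
    · right
      have h1 := hez e he t ht
      have h2 := hd t htJ
      simp only [Submodule.coe_smul, Pi.smul_apply, smul_eq_mul]
      linarith
    · left
      simp [hz t ht htJ]
  obtain ⟨φ, hφ⟩ : ∃ φ : ℝ → ℝ, ∀ e : ℝ, φ e = (‖vel x‖ ^ 2 +
      2 * e * (inner ℂ (vel x) (vel z) : ℂ).re + e ^ 2 * ‖vel z‖ ^ 2) / 2 +
      ∫ t in Icc a b, m / α / ‖(x : ℝ → ℂ) t + (e : ℂ) * (z : ℝ → ℂ) t‖ ^ α :=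
    ⟨_, fun _ => rfl⟩
  have hact : ∀ e : ℝ, |e| < ε → action m α T (x + (e : ℂ) • z : H1Curve T) =
      ENNReal.ofReal (φ e) +
        ∫⁻ t in Icc (-T) T \ Icc a b, potential m α ((x : ℝ → ℂ) t) := by
    intro e he
    rw [action_eq_split hm hα hab (hne e he), norm_vel_add_smul_sq, hφ]
    congr 1
    refine setLIntegral_congr_fun (measurableSet_Icc.diff measurableSet_Icc) fun t ht => ?_
    simp [hz t ht.1 ht.2]
  have hφ0 : ∀ e, |e| < ε → 0 ≤ φ e := fun e _ => by
    rw [hφ]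
    refine add_nonneg ?_ (integral_nonneg fun t => by positivity)
    rw [← norm_vel_add_smul_sq]
    positivity
  have hloc : IsLocalMin φ 0 := by
    have hnb : ∀ᶠ e : ℝ in 𝓝 0, |e| < ε := by
      have := Metric.ball_mem_nhds (0 : ℝ) hε0
      filter_upwards [this] with e he
      simpa using he
    filter_upwards [hnb] with e he
    have h1 := hmin _ (hmem e he)
    have h2 := hact 0 (by simpa using hε0)
    simp only [Complex.ofReal_zero, zero_smul, add_zero] at h2
    rw [hact e he, h2] at h1
    rw [h2] at hfin
    have h3 := ENNReal.le_of_add_le_add_right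
      (ne_top_of_le_ne_top hfin.ne le_add_self) h1
    exact (ENNReal.ofReal_le_ofReal_iff (hφ0 e he)).1 h3
  have hder : HasDerivAt (fun e : ℝ =>
      ∫ t in Icc a b, m / α / ‖(x : ℝ → ℂ) t + (e : ℂ) * (z : ℝ → ℂ) t‖ ^ α)
      (∫ t in Icc a b, inner ℝ (force m α ((x : ℝ → ℂ) t + ((0 : ℝ) : ℂ) * (z : ℝ → ℂ) t))
        ((z : ℝ → ℂ) t)) 0 := by
    have hball : ∀ e : ℝ, e ∈ Metric.ball (0 : ℝ) ε → |e| < ε := fun e he => by simpa using he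
    refine (hasDerivAt_integral_of_dominated_loc_of_deriv_le
      (𝕜 := ℝ) (F := fun (e : ℝ) t => m / α / ‖(x : ℝ → ℂ) t + (e : ℂ) * (z : ℝ → ℂ) t‖ ^ α)
      (F' := fun (e : ℝ) t => inner ℝ (force m α ((x : ℝ → ℂ) t + (e : ℂ) * (z : ℝ → ℂ) t))
        ((z : ℝ → ℂ) t))
      (bound := fun _ => m / (d / 2) ^ (α + 2) * (B + d / 2) * N)
      (Metric.ball_mem_nhds (0 : ℝ) hε0) ?_ ?_ ?_ ?_ ?_ ?_).2
    · filter_upwards [Metric.ball_mem_nhds (0 : ℝ) hε0] with e he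
      exact (hcont e (hball e he)).aestronglyMeasurable measurableSet_Icc
    · exact (hcont 0 (by simpa using hε0)).integrableOn_compact isCompact_Icc
    · refine ContinuousOn.aestronglyMeasurable ?_ measurableSet_Icc
      refine ContinuousOn.inner (fun t ht => ?_) ((continuousOn_curve z).mono hab)
      exact ContinuousAt.comp_continuousWithinAt (g := force m α)
        (f := fun t => (x : ℝ → ℂ) t + ((0 : ℝ) : ℂ) * (z : ℝ → ℂ) t)
        (continuousAt_force m α (hne 0 (by simpa using hε0) t ht))
        ((((continuousOn_curve x).mono hab).add
          (continuousOn_const.mul ((continuousOn_curve z).mono hab))) t ht)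
    · refine (ae_restrict_iff' measurableSet_Icc).2 (ae_of_all _ fun t ht e he => ?_)
      refine (norm_inner_le_norm _ _).trans ?_
      have h1 : ‖(x : ℝ → ℂ) t + (e : ℂ) * (z : ℝ → ℂ) t‖ ≤ B + d / 2 :=
        (norm_add_le _ _).trans (add_le_add (hB t (hab ht)) (hez e (hball e he) t (hab ht)))
      have h2 := norm_force_le hm hα (half_pos hd0) (hlow e (hball e he) t ht) h1
      have h3 := hN t (hab ht)
      gcongr
      exact (norm_nonneg _).trans h2
    · exact integrable_const _
    · refine (ae_restrict_iff' measurableSet_Icc).2 (ae_of_all _ fun t ht e he => ?_)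
      exact hasDerivAt_potential hα (hne e (hball e he) t ht)
  have hφd : HasDerivAt φ ((inner ℂ (vel x) (vel z) : ℂ).re +
      ∫ t in Icc a b, inner ℝ (force m α ((x : ℝ → ℂ) t + ((0 : ℝ) : ℂ) * (z : ℝ → ℂ) t))
        ((z : ℝ → ℂ) t)) 0 := by
    rw [funext hφ]
    refine HasDerivAt.add ?_ hder
    have h1 : HasDerivAt (fun e : ℝ => 2 * e * (inner ℂ (vel x) (vel z) : ℂ).re)
        (2 * (inner ℂ (vel x) (vel z) : ℂ).re) 0 :=
      (hasDerivAt_const_mul (2 : ℝ)).mul_const _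
    have h2 : HasDerivAt (fun e : ℝ => e ^ 2 * ‖vel z‖ ^ 2) (0 * ‖vel z‖ ^ 2) 0 := by
      have := (hasDerivAt_pow 2 (0 : ℝ)).mul_const (‖vel z‖ ^ 2)
      simpa using this
    refine (((h1.const_add (‖vel x‖ ^ 2)).add h2).div_const 2).congr_deriv ?_
    ring
  have hzero := hloc.hasDerivAt_eq_zero hφd
  simpa using hzero

theorem integrable_inner_of_memLp {T : ℝ} {f g : ℝ → ℂ} (hf : MemLp f 2 (timeMeasure T))
    (hg : MemLp g 2 (timeMeasure T)) :
    Integrable (fun t => inner ℝ (f t) (g t)) (timeMeasure T) := by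
  refine (L2.integrable_inner (𝕜 := ℝ) (hf.toLp f) (hg.toLp g)).congr ?_
  filter_upwards [hf.coeFn_toLp, hg.coeFn_toLp] with t h1 h2
  rw [h1, h2]

/-- On a collision-free interval a minimizer is a classical solution. -/
theorem exists_solution_of_minimizer {m α T φm φp : ℝ} (hm : 0 < m) (hα : 0 < α) (hT : 0 < T)
    {x : H1Curve T} (hx : x ∈ Gamma m α T φm φp)
    (hmin : ∀ y ∈ Gamma m α T φm φp, action m α T x ≤ action m α T y)
    (hfin : action m α T x < ⊤) {a b : ℝ} (ha : -T ≤ a) (hab : a < b) (hb : b ≤ T)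
    (h0 : ∀ t ∈ Icc a b, (x : ℝ → ℂ) t ≠ 0) :
    ∃ q q₁ : ℝ → ℂ, (∀ t ∈ Icc a b, (x : ℝ → ℂ) t = q t) ∧ (∀ t, HasDerivAt q (q₁ t) t) ∧
      ∀ t ∈ Icc a b, HasDerivAt q₁ (force m α ((x : ℝ → ℂ) t)) t := by
  have hsub : Icc a b ⊆ Icc (-T) T := Icc_subset_Icc ha hb
  have hgc : ContinuousOn (fun t => force m α ((x : ℝ → ℂ) t)) (Icc a b) := fun t ht =>
    ContinuousAt.comp_continuousWithinAt (g := force m α) (f := (x : ℝ → ℂ))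
      (continuousAt_force m α (h0 t ht)) ((continuousOn_curve x).mono hsub t ht)
  obtain ⟨g, hg, hgx⟩ : ∃ g : ℝ → ℂ, Continuous g ∧
      ∀ t ∈ Icc a b, g t = force m α ((x : ℝ → ℂ) t) :=
    ⟨IccExtend hab.le ((Icc a b).domRestrict fun t => force m α ((x : ℝ → ℂ) t)),
      (continuousOn_iff_continuous_domRestrict.1 hgc).Icc_extend', fun t ht =>
      IccExtend_of_mem _ _ ht⟩
  have hprim : ∀ {f : ℝ → ℂ}, Continuous f → ∀ t, HasDerivAt (fun t => ∫ u in a..t, f u) (f t) t :=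
    fun hf t => intervalIntegral.integral_hasDerivAt_right (hf.intervalIntegrable _ _)
      (hf.stronglyMeasurableAtFilter _ _) hf.continuousAt
  obtain ⟨p, hp⟩ : ∃ p : ℝ → ℂ, p = fun t => ∫ u in a..t, g u := ⟨_, rfl⟩
  have hpd : ∀ t, HasDerivAt p (g t) t := fun t => hp ▸ hprim hg t
  have hpc : Continuous p := continuous_iff_continuousAt.2 fun t => (hpd t).continuousAt
  -- With the force frozen along `x`, the problem `q'' = g` is linear; `c` is the initial velocity
  -- for which `q` meets `x` at `b`.
  obtain ⟨c, hc⟩ : ∃ c : ℂ, c = ((x : ℝ → ℂ) b - (x : ℝ → ℂ) a - ∫ u in a..b, p u) /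
      ((b - a : ℝ) : ℂ) := ⟨_, rfl⟩
  obtain ⟨q, hq⟩ : ∃ q : ℝ → ℂ, q = fun t => (x : ℝ → ℂ) a + ((∫ u in a..t, p u) +
      ((t - a : ℝ) : ℂ) * c) := ⟨_, rfl⟩
  have hqd : ∀ t, HasDerivAt q (p t + c) t := fun t => by
    have h1 : HasDerivAt (fun t : ℝ => ((t - a : ℝ) : ℂ) * c) c t := by
      simpa using (((hasDerivAt_id t).sub_const a).ofReal_comp).mul_const c
    rw [hq]
    exact ((hprim hpc t).add h1).const_add _
  have hq₁d : ∀ t, HasDerivAt (fun t => p t + c) (g t) t := fun t => (hpd t).add_const c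
  have hq₁c : Continuous fun t => p t + c := hpc.add continuous_const
  have hba : ((b - a : ℝ) : ℂ) ≠ 0 := by
    exact_mod_cast (sub_pos.2 hab).ne'
  have hqa : q a = (x : ℝ → ℂ) a := by simp [hq]
  have hqb : q b = (x : ℝ → ℂ) b := by
    simp only [hq, hc]
    rw [mul_div_cancel₀ _ hba]
    ring
  obtain ⟨z, hzJ, hz0, hzl, hzr, hzd⟩ := exists_replacement hT x ha hab hb hqd hq₁c hqa hqb
  have hfv := first_variation hm hα hT hx hmin hfin hsub h0 hz0 hzl hzr
  have hparts := integral_inner_deriv_add hT hq₁d hg hzl hzr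
  have hzL := z.2.memLp_deriv
  have hq₁L : MemLp (fun t => p t + c) 2 (timeMeasure T) := by
    obtain ⟨C, hC⟩ := isCompact_Icc.exists_bound_of_continuousOn (s := Icc (-T) T)
      hq₁c.continuousOn
    exact MemLp.of_bound hq₁c.aestronglyMeasurable C
      ((ae_restrict_iff' measurableSet_Icc).2 (ae_of_all _ hC))
  have hi1 : Integrable (fun t => inner ℝ (p t + c) (deriv (z : ℝ → ℂ) t)) (timeMeasure T) :=
    integrable_inner_of_memLp hq₁L hzL
  have hi2 : Integrable (fun t => inner ℝ (deriv (x : ℝ → ℂ) t) (deriv (z : ℝ → ℂ) t))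
      (timeMeasure T) := integrable_inner_of_memLp x.2.memLp_deriv hzL
  have hi3 : Integrable (fun t => inner ℝ (g t) ((z : ℝ → ℂ) t)) (timeMeasure T) :=
    (hg.continuousOn.inner (continuousOn_curve z)).integrableOn_compact isCompact_Icc
  rw [integral_add hi1 hi3] at hparts
  have hforce : ∫ t in Icc (-T) T, inner ℝ (g t) ((z : ℝ → ℂ) t) =
      ∫ t in Icc a b, inner ℝ (force m α ((x : ℝ → ℂ) t)) ((z : ℝ → ℂ) t) := by
    rw [setIntegral_eq_of_subset_of_forall_sdiff_eq_zero measurableSet_Icc hsub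
      (fun t ht => by rw [hz0 t ht.1 ht.2, inner_zero_right])]
    exact setIntegral_congr_fun measurableSet_Icc fun t ht => by simp only [hgx t ht]
  rw [re_inner_vel] at hfv
  rw [hforce] at hparts
  -- The variation `z = q - x` is tested both in the first variation of `x` and in the equation of
  -- `q`. The force terms cancel in the difference, leaving the integral of `‖z'‖ ^ 2`.
  have henergy : ‖vel z‖ ^ 2 = 0 := by
    rw [norm_vel_sq]
    have h1 : ∫ t in Icc (-T) T, ‖deriv (z : ℝ → ℂ) t‖ ^ 2 =
        ∫ t in Icc (-T) T, (inner ℝ (p t + c) (deriv (z : ℝ → ℂ) t) -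
          inner ℝ (deriv (x : ℝ → ℂ) t) (deriv (z : ℝ → ℂ) t)) := by
      refine integral_congr_ae ?_
      filter_upwards [hzd] with t ht
      rw [← inner_sub_left, ← real_inner_self_eq_norm_sq, ht]
      by_cases htJ : t ∈ Ioc a b
      · rw [indicator_of_mem htJ]
      · rw [indicator_of_notMem htJ, inner_zero_right, inner_zero_right]
    rw [h1, integral_sub hi1 hi2]
    linarith
  have hz : ∀ t ∈ Icc (-T) T, (z : ℝ → ℂ) t = 0 := fun t ht => by
    have h1 := norm_sub_le_sqrt z (left_mem_Icc.2 (by linarith : -T ≤ T)) ht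
    rw [pow_eq_zero_iff two_ne_zero] at henergy
    rw [henergy, mul_zero, hzl, sub_zero] at h1
    exact norm_le_zero_iff.1 h1
  refine ⟨q, fun t => p t + c, fun t ht => ?_, hqd, fun t ht => hgx t ht ▸ hq₁d t⟩
  have h1 := hzJ t ht
  rw [hz t (hsub ht)] at h1
  exact (sub_eq_zero.1 h1.symm).symm

/-- A minimizer solves the equation of motion away from its collisions. -/
theorem isSolutionOn_of_minimizer {m α T φm φp : ℝ} (hm : 0 < m) (hα : 0 < α) (hT : 0 < T)
    {x : H1Curve T} (hx : x ∈ Gamma m α T φm φp)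
    (hmin : ∀ y ∈ Gamma m α T φm φp, action m α T x ≤ action m α T y)
    (hfin : action m α T x < ⊤) :
    IsSolutionOn m α {t ∈ Icc (-T) T | (x : ℝ → ℂ) t ≠ 0} (x : ℝ → ℂ) := by
  obtain ⟨s, hs⟩ : ∃ s, s = {t ∈ Icc (-T) T | (x : ℝ → ℂ) t ≠ 0} := ⟨_, rfl⟩
  rw [← hs]
  have hsI : s ⊆ Icc (-T) T := hs ▸ sep_subset _ _
  have hle : -T < T := by linarith
  have hnear : ∀ t ∈ s, s ∈ 𝓝[Icc (-T) T] t := fun t ht => by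
    have ht' : t ∈ Icc (-T) T ∧ (x : ℝ → ℂ) t ≠ 0 := by simpa [hs] using ht
    have h1 := (continuousOn_curve x t ht'.1).eventually_ne ht'.2
    filter_upwards [h1, self_mem_nhdsWithin] with u hu1 hu2
    rw [hs]; exact ⟨hu2, hu1⟩
  have hlocal : ∀ t ∈ s, ∃ (J : Set ℝ) (q q₁ : ℝ → ℂ), J ∈ 𝓝[s] t ∧ J ⊆ s ∧
      (∀ u ∈ J, (x : ℝ → ℂ) u = q u) ∧ (∀ u, HasDerivAt q (q₁ u) u) ∧
      ∀ u ∈ J, HasDerivAt q₁ (force m α ((x : ℝ → ℂ) u)) u := by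
    intro t ht
    obtain ⟨δ, hδ, hball⟩ := Metric.mem_nhdsWithin_iff.1 (hnear t ht)
    have htI := hsI ht
    -- The alternatives `a = -T` and `b = T` make `[a, b]` a relative neighbourhood of `t` at the
    -- end points as well.
    obtain ⟨a, haT, hat, hab1, ha2⟩ : ∃ a, -T ≤ a ∧ a ≤ t ∧ t - δ < a ∧ (a < t ∨ a = -T) := by
      refine ⟨max (-T) (t - δ / 2), le_max_left _ _, max_le htI.1 (by linarith),
        lt_max_of_lt_right (by linarith), ?_⟩
      rcases le_total (-T) (t - δ / 2) with h | h
      · left; rw [max_eq_right h]; linarith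
      · right; exact max_eq_left h
    obtain ⟨b, hbT, htb, hbb1, hb2⟩ : ∃ b, b ≤ T ∧ t ≤ b ∧ b < t + δ ∧ (t < b ∨ b = T) := by
      refine ⟨min T (t + δ / 2), min_le_left _ _, le_min htI.2 (by linarith),
        min_lt_of_right_lt (by linarith), ?_⟩
      rcases le_total T (t + δ / 2) with h | h
      · right; exact min_eq_left h
      · left; rw [min_eq_right h]; linarith
    have hab : a < b := by
      rcases ha2 with h | h
      · linarith
      · rcases hb2 with h' | h'
        · linarith
        · linarith
    have hJs : Icc a b ⊆ s := fun u hu => hball ⟨by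
      rw [Metric.mem_ball, Real.dist_eq, abs_lt]
      constructor <;> linarith [hu.1, hu.2], haT.trans hu.1, hu.2.trans hbT⟩
    obtain ⟨q, q₁, h1, h2, h3⟩ := exists_solution_of_minimizer hm hα hT hx hmin hfin haT hab hbT
      (fun u hu => by
        have := hJs hu
        rw [hs] at this
        exact this.2)
    refine ⟨Icc a b, q, q₁, ?_, hJs, h1, h2, h3⟩
    refine nhdsWithin_mono _ hsI ?_
    rcases ha2 with h | h <;> rcases hb2 with h' | h'
    · exact mem_nhdsWithin_of_mem_nhds (Icc_mem_nhds h h')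
    · rw [h']
      filter_upwards [self_mem_nhdsWithin, mem_nhdsWithin_of_mem_nhds (Ioi_mem_nhds h)] with u hu hu'
        using ⟨le_of_lt hu', hu.2⟩
    · rw [h]
      filter_upwards [self_mem_nhdsWithin, mem_nhdsWithin_of_mem_nhds (Iio_mem_nhds h')] with u hu hu'
        using ⟨hu.1, le_of_lt hu'⟩
    · rw [h, h']
      exact self_mem_nhdsWithin
  -- Uniqueness of derivatives within `s` identifies `derivWithin x s` with every local velocity
  -- `q₁`, so the local solutions share one velocity.
  have huniq : ∀ t ∈ s, UniqueDiffWithinAt ℝ s t := fun t ht => by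
    have h1 := (uniqueDiffOn_Icc hle t (hsI ht)).inter' (hnear t ht)
    rwa [inter_eq_right.2 hsI] at h1
  have hderiv : ∀ t ∈ s, ∀ (J : Set ℝ) (q q₁ : ℝ → ℂ), J ∈ 𝓝[s] t →
      (∀ u ∈ J, (x : ℝ → ℂ) u = q u) → (∀ u, HasDerivAt q (q₁ u) u) →
      HasDerivWithinAt (x : ℝ → ℂ) (q₁ t) s t := fun t ht J q q₁ hJ h1 h2 =>
    (h2 t).hasDerivWithinAt.congr_of_eventuallyEq (mem_of_superset hJ h1)
      (h1 t (mem_of_mem_nhdsWithin ht hJ))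
  refine ⟨fun t => derivWithin (x : ℝ → ℂ) s t, fun t ht => ?_⟩
  obtain ⟨J, q, q₁, hJ, hJs, h1, h2, h3⟩ := hlocal t ht
  have hev : (fun t => derivWithin (x : ℝ → ℂ) s t) =ᶠ[𝓝[s] t] q₁ := by
    filter_upwards [eventually_mem_nhdsWithin_iff.2 hJ, self_mem_nhdsWithin] with u hu hus
    exact (hderiv u hus J q q₁ hu h1 h2).derivWithin (huniq u hus)
  refine ⟨?_, ?_, ?_⟩
  · rw [hs] at ht
    exact ht.2
  · have h4 := hderiv t ht J q q₁ hJ h1 h2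
    exact h4.differentiableWithinAt.hasDerivWithinAt
  · exact (h3 t (mem_of_mem_nhdsWithin ht hJ)).hasDerivWithinAt.congr_of_eventuallyEq hev
      (hev.self_of_nhdsWithin ht)

/-! ### Existence of minimizers -/

theorem iInf_GammaStar_le {m α T φm φp : ℝ} (hm : 0 < m) (hα : 0 < α) (hα2 : α < 2)
    (hT : 0 < T) :
    ⨅ x ∈ GammaStar m α T φm φp, action m α T x ≤
      ENNReal.ofReal (2 * jacobi m α (rbar m α T)) := by
  refine ENNReal.le_of_forall_pos_le_add fun ε hε _ => ?_
  obtain ⟨x, hx, hxa⟩ := exists_mem_GammaStar_action_le (φm := φm) (φp := φp) hm hα hα2 hT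
    (ε := ε) (by exact_mod_cast hε)
  refine (iInf₂_le x hx).trans (hxa.trans ?_)
  rw [← ENNReal.ofReal_coe_nnreal]
  exact ENNReal.ofReal_add_le

/-- This allows a minimizing sequence inside `GammaStar`, whose weak limit lies in `Gamma` by
definition; no closedness of `Gamma` under further weak limits is needed. Curves with collisions do
not lower the infimum, since short circular arcs approach their lower bound. -/
theorem cbar_eq_iInf_GammaStar {m α T φm φp : ℝ} (hm : 0 < m) (hα : 0 < α) (hα2 : α < 2)
    (hT : 0 < T) :
    cbar m α T φm φp = ⨅ x ∈ GammaStar m α T φm φp, action m α T x := by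
  refine le_antisymm (biInf_mono fun x hx => GammaStar_subset_Gamma hx) ?_
  refine le_iInf₂ fun y hy => ?_
  by_cases h0 : ∀ t ∈ Icc (-T) T, (y : ℝ → ℂ) t ≠ 0
  · exact iInf₂_le y (mem_GammaStar_of_mem_Gamma hT hy h0)
  · push Not at h0
    obtain ⟨t, ht, hyt⟩ := h0
    obtain ⟨hl, hr⟩ := apply_of_mem_Gamma hT hy
    exact (iInf_GammaStar_le hm hα hα2 hT).trans
      (two_jacobi_le_action hm hα hα2 hT hl hr ht hyt)

theorem cbar_lt_top {m α T φm φp : ℝ} (hm : 0 < m) (hα : 0 < α) (hα2 : α < 2) (hT : 0 < T) :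
    cbar m α T φm φp < ⊤ := by
  rw [cbar_eq_iInf_GammaStar hm hα hα2 hT]
  exact (iInf_GammaStar_le hm hα hα2 hT).trans_lt ENNReal.ofReal_lt_top

theorem exists_minimizer {m α T φm φp : ℝ} (hm : 0 < m) (hα : 0 < α) (hα2 : α < 2)
    (hT : 0 < T) :
    ∃ γ ∈ Gamma m α T φm φp, action m α T γ = cbar m α T φm φp := by
  have hfin := cbar_lt_top (φm := φm) (φp := φp) hm hα hα2 hT
  obtain ⟨x₀, hx₀, -⟩ := exists_mem_GammaStar_action_le (φm := φm) (φp := φp) hm hα hα2 hT one_pos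
  obtain ⟨u, -, hu, hux⟩ := exists_seq_tendsto_sInf (S := (fun x : H1Curve T => action m α T x) ''
    GammaStar m α T φm φp) ⟨_, x₀, hx₀, rfl⟩ (OrderBot.bddBelow _)
  rw [sInf_image, ← cbar_eq_iInf_GammaStar hm hα hα2 hT] at hu
  choose x hx hxu using hux
  obtain ⟨N, hN⟩ := eventually_atTop.1 (hu.eventually (gt_mem_nhds
    (ENNReal.lt_add_right hfin.ne one_ne_zero)))
  have hM : ∀ n, ‖vel (x (n + N))‖ ≤
      √(2 * (cbar m α T φm φp + 1).toReal) := fun n => by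
    have h1 : ENNReal.ofReal (‖vel (x (n + N))‖ ^ 2 / 2) ≤ cbar m α T φm φp + 1 := by
      refine le_trans ?_ (hN (n + N) (Nat.le_add_left _ _)).le
      rw [← hxu]
      simp only [action_eq]
      exact le_self_add
    rw [ENNReal.ofReal_le_iff_le_toReal (by finiteness)] at h1
    exact Real.le_sqrt_of_sq_le (by linarith)
  obtain ⟨γ, φ, hφ, hγ⟩ := exists_weak_limit hT (x := fun n => x (n + N)) hM
    (fun n => (hx (n + N)).2.1)
  have hmem : γ ∈ Gamma m α T φm φp := ⟨_, fun n => hx (φ n + N), hγ⟩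
  refine ⟨γ, hmem, le_antisymm ?_ (iInf₂_le γ hmem)⟩
  refine action_le_of_weaklyTendsto hT hγ (fun n => (hx (φ n + N)).2.1) ?_
  have h2 := ((tendsto_add_atTop_iff_nat N).2 hu).comp hφ.tendsto_atTop
  refine h2.congr fun n => ?_
  exact (hxu (φ n + N)).symm

/-- Minimizers are collision-free if the angle, measured in the plane of `x ^ (1 - α / 2)`, is
less than `π`. -/
theorem minimizer_mem_GammaStar {m α T φm φp : ℝ} (hm : 0 < m) (hα : 0 < α) (hα2 : α < 2)
    (hT : 0 < T) (hφ : (1 - α / 2) * |φp - φm| < Real.pi) {γ : H1Curve T}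
    (hγ : γ ∈ Gamma m α T φm φp) (hγc : action m α T γ = cbar m α T φm φp) :
    γ ∈ GammaStar m α T φm φp ∧
      action m α T γ < action m α T (xbar m α φm φp) := by
  obtain ⟨x, hx, hxa⟩ := exists_mem_GammaStar_action_lt hm hα hα2 hT hφ
  have hlt : action m α T γ < ENNReal.ofReal (2 * jacobi m α (rbar m α T)) := by
    rw [hγc]
    exact (iInf₂_le x (GammaStar_subset_Gamma hx)).trans_lt hxa
  refine ⟨mem_GammaStar_of_mem_Gamma hT hγ fun t ht h0 => ?_,
    hlt.trans_le (two_jacobi_le_action_xbar hm hα hα2 hT)⟩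
  obtain ⟨hl, hr⟩ := apply_of_mem_Gamma hT hγ
  exact absurd (two_jacobi_le_action hm hα hα2 hT hl hr ht h0) (not_le.2 hlt)

/-- The factor `1 - α / 2` is at most `1 / 2`, so strictness in either hypothesis suffices. -/
theorem angle_lt_pi {α δ : ℝ} (hα : 1 ≤ α) (hα2 : α < 2) (hδ : |δ| ≤ 2 * Real.pi)
    (h : 1 < α ∨ |δ| < 2 * Real.pi) : (1 - α / 2) * |δ| < Real.pi := by
  have hpi := Real.pi_pos
  have h0 := abs_nonneg δ
  rcases h with h | h
  · nlinarith
  · nlinarith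

end Kepler

end

/-! ### The main theorem -/

theorem theorem3 (m α T φm φp : ℝ) (hm : 0 < m) (hα : 1 ≤ α) (hα2 : α < 2) (hT : 0 < T)
    (hφ : |φp - φm| ≤ 2 * Real.pi) :
    (Kepler.cbar m α T φm φp < ⊤ ∧
      ∃ γ ∈ Kepler.Gamma m α T φm φp,
        Kepler.action m α T (γ : ℝ → ℂ) = Kepler.cbar m α T φm φp) ∧
    ∀ γ ∈ Kepler.Gamma m α T φm φp,
      Kepler.action m α T (γ : ℝ → ℂ) = Kepler.cbar m α T φm φp →
      (1 < α →
        γ ∈ Kepler.GammaStar m α T φm φp ∧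
        Kepler.action m α T (γ : ℝ → ℂ) < Kepler.action m α T (Kepler.xbar m α φm φp)) ∧
      (α = 1 → |φp - φm| < 2 * Real.pi →
        γ ∈ Kepler.GammaStar m α T φm φp ∧
        Kepler.action m α T (γ : ℝ → ℂ) < Kepler.action m α T (Kepler.xbar m α φm φp)) ∧
      (φp ≠ φm →
        (1 < α ∨ |φp - φm| < 2 * Real.pi →
          Kepler.IsSolutionOn m α (Icc (-T) T) (γ : ℝ → ℂ)) ∧
        Kepler.IsSolutionOn m α {t ∈ Icc (-T) T | (γ : ℝ → ℂ) t ≠ 0} (γ : ℝ → ℂ)) := by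
  have hα0 : 0 < α := by linarith
  have hfin := Kepler.cbar_lt_top (φm := φm) (φp := φp) hm hα0 hα2 hT
  refine ⟨⟨hfin, Kepler.exists_minimizer hm hα0 hα2 hT⟩, fun γ hγ hγc => ?_⟩
  have hstar : 1 < α ∨ |φp - φm| < 2 * Real.pi → γ ∈ Kepler.GammaStar m α T φm φp ∧
      Kepler.action m α T (γ : ℝ → ℂ) < Kepler.action m α T (Kepler.xbar m α φm φp) := fun h =>
    Kepler.minimizer_mem_GammaStar hm hα0 hα2 hT (Kepler.angle_lt_pi hα hα2 hφ h) hγ hγc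
  have hsol := Kepler.isSolutionOn_of_minimizer hm hα0 hT hγ
    (fun y hy => hγc.trans_le (iInf₂_le y hy)) (hγc ▸ hfin)
  refine ⟨fun h => hstar (Or.inl h), fun _ h => hstar (Or.inr h), fun _ => ⟨fun h => ?_, hsol⟩⟩
  have h0 := (hstar h).1.1
  rwa [sep_eq_self_iff_mem_true.2 h0] at hsol
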